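/- Let $n\ge 1$. Let $f$ be an analytic map from an open set $U\subseteq\mathbb C^n$ to $\mathbb C^n$ whose fixed points in $U$ are isolated. Assume that near each fixed point $\mathbf q\in U$ the map $f$ is a local diffeomorphism ($\det \mathrm Df(\mathbf q)\ne 0$) with $n$ functionally independent meromorphic first integrals. This means that there are quotients $G_i/H_i$ ($i=1,\dots,n$) of functions analytic near $\mathbf q$, with $H_i\not\equiv 0$ and $G_i(f(x))H_i(x)=G_i(x)H_i(f(x))$ for all $x$ near $\mathbf q$, whose differentials are linearly independent on a dense subset of a neighbourhood of $\mathbf q$. (1) For every fixed point $\mathbf q$ of $f$ there is an integer $p\ge1$ such that all the eigenvalues $\mu$ of $\mathrm Df(\mathbf q)$ satisfy $\mu^p=1$. (2) If $U=\mathbb C^n$, there is a nonzero polynomial $P\in\mathbb C[x]$ with $P(\mu)=0$ for all eigenvalues $\mu$ of $\mathrm Df(\mathbf q)$ at all fixed points $\mathbf q$. (3) Let $K$ be a subfield of $\mathbb C$ (for instance $\mathbb C$ or $\mathbb Q$), let $f=(N_1/D_1,\dots,N_n/D_n)$ be a rational map with $N_i,D_i\in K[x_1,\dots,x_n]$ relatively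 prime and $D_i\ne0$, and let $U=\{D_1\cdots D_n\neq 0\}$. Let $R(\mathbf x,\mu)\in K[\mathbf x,\mu]$ be the numerator, in lowest terms, of the characteristic polynomial $\det(\mu\,\mathrm{Id}-\mathrm Df(\mathbf x))$. Consider the system in the unknowns $t,x_1,\dots,x_n$, with coefficients in $K[\mu]$, $$N_i-x_iD_i=0\quad(1\le i\le n),\qquad 1-t\,D_1\cdots D_n=0,\qquad R(\mathbf x,\mu)=0 .$$ Eliminate the unknowns one after the other. At each step first make an invertible linear change of the remaining unknowns, with coefficients in $K$; then replace the system by the set of all resultants $\operatorname{Res}(A,B)$ with respect to the first unknown, where $A,B$ are $K$-linear combinations of the equations and $A$ involves that unknown, together with all $K$-linear combinations of the equations that do not involve that unknown. A polynomial $P\in K[\mu]$ that belongs to the last system, for some choice of the linear changes, is said to be obtained by successive resultants. Then some nonzero $P\in K[\mu]$ is obtained by successive resultants, and every $P\in K[\mu]$ so obtained satisfies $P(\mu)=0$ for all eigenvalues $\mu$ of $\mathrm Df(\mathbf q)$ at all fixed points $\mathbf q\in U$. (4) In (3) let $K=\mathbb Q$, let $P_k\in\mathbb Q[x]$ be any nonzero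 polynomial obtained by successive resultants, let $k$ be its degree, and suppose that $f$ has a fixed point $\mathbf q\in U$. Denote by $\Phi_m$ the $m$-th cyclotomic polynomial. Then the maximum $M$ of all integers $m\ge1$ with $\deg\Phi_m\le k$ exists, and every eigenvalue of $\mathrm Df(\mathbf q)$ is a primitive $p$-th root of unity for some $1\le p\le M$. Moreover, $\operatorname{Res}_x(\Phi_j(x),P_k(x))=0$ for some $j\ge1$ with $\deg\Phi_j\le k$. -/

import Mathlib

open Filter Topology

namespace MeroInt

/-! ### Meromorphic first integrals of germs of analytic maps of `ℂⁿ` -/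

/-- `G / H`, with `G` and `H` analytic near `q` and `H` not identically zero near `q`, is a
meromorphic first integral, near `q`, of the map `f`. -/
def IsMeromorphicFirstIntegral {n : ℕ} (f : (Fin n → ℂ) → (Fin n → ℂ)) (q : Fin n → ℂ)
    (G H : (Fin n → ℂ) → ℂ) : Prop :=
  AnalyticAt ℂ G q ∧ AnalyticAt ℂ H q ∧ (¬ ∀ᶠ x in 𝓝 q, H x = 0) ∧
    ∀ᶠ x in 𝓝 q, G (f x) * H x = G x * H (f x)

/-- The functions `G i / H i` are functionally independent near `q`: on a neighbourhood of `q`,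
their differentials are defined and linearly independent on a dense set of points. -/
def FunctionallyIndependentAt {n m : ℕ} (q : Fin n → ℂ)
    (G H : Fin m → (Fin n → ℂ) → ℂ) : Prop :=
  ∃ V ∈ 𝓝 q, V ⊆ closure {x ∈ V | (∀ i, H i x ≠ 0) ∧
    LinearIndependent ℂ (fun i : Fin m => fderiv ℂ (fun y => G i y / H i y) x)}

/-- `f` is an analytic map from the open set `U ⊆ ℂⁿ` to `ℂⁿ` whose fixed points are isolated, and
near each fixed point `f` is a local diffeomorphism with `n` functionally independent meromorphic
first integrals. -/
structure IsIntegrableMap {n : ℕ} (U : Set (Fin n → ℂ)) (f : (Fin n → ℂ) → (Fin n → ℂ)) :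
    Prop where
  isOpen : IsOpen U
  analytic : AnalyticOnNhd ℂ f U
  isolated : ∀ q ∈ U, f q = q → ∀ᶠ x in 𝓝 q, f x = x → x = q
  invertible : ∀ q ∈ U, f q = q → (fderiv ℂ f q).det ≠ 0
  integrals : ∀ q ∈ U, f q = q → ∃ G H : Fin n → (Fin n → ℂ) → ℂ,
    (∀ i, IsMeromorphicFirstIntegral f q (G i) (H i)) ∧ FunctionallyIndependentAt q G H

/-- `μ` is an eigenvalue of the differential of `f` at `q`. -/
def IsEigenvalueAt {n : ℕ} (f : (Fin n → ℂ) → (Fin n → ℂ)) (q : Fin n → ℂ) (μ : ℂ) : Prop :=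
  Module.End.HasEigenvalue (fderiv ℂ f q : (Fin n → ℂ) →ₗ[ℂ] (Fin n → ℂ)) μ

/-! ### Rational maps -/

section Rational

variable {K : Type} [Field K]

/-- The set where all the denominators `D i` are nonzero. -/
def ratDomain [Algebra K ℂ] {n : ℕ} (D : Fin n → MvPolynomial (Fin n) K) : Set (Fin n → ℂ) :=
  {x | ∀ i, MvPolynomial.aeval x (D i) ≠ 0}

/-- The rational map with components `N i / D i`. It is only ever considered on `ratDomain D`. -/
noncomputable def ratMap [Algebra K ℂ] {n : ℕ} (N D : Fin n → MvPolynomial (Fin n) K) :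
    (Fin n → ℂ) → (Fin n → ℂ) :=
  fun x i => MvPolynomial.aeval x (N i) / MvPolynomial.aeval x (D i)

/-- A polynomial in `x₁, …, xₙ` over `K`, seen as a polynomial in `x₁, …, xₙ` over `K[μ]`. -/
noncomputable def liftCoeff {n : ℕ} :
    MvPolynomial (Fin n) K →+* MvPolynomial (Fin n) (Polynomial K) :=
  MvPolynomial.map Polynomial.C

/-- With `f i = N i / D i`, the matrix `μ • 1 - Df(x)` with its `i`-th row multiplied by
`(D i)²`; the entries are polynomials in `x₁, …, xₙ` over `K[μ]`. -/
noncomputable def charMatrixCleared {n : ℕ} (N D : Fin n → MvPolynomial (Fin n) K) :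
    Matrix (Fin n) (Fin n) (MvPolynomial (Fin n) (Polynomial K)) :=
  fun i j =>
    (if i = j then MvPolynomial.C Polynomial.X * liftCoeff (D i) ^ 2 else 0) -
      liftCoeff (MvPolynomial.pderiv j (N i) * D i - N i * MvPolynomial.pderiv j (D i))

/-- `R` is the numerator, in lowest terms, of the characteristic polynomial
`det (μ • 1 - Df(x)) = det (charMatrixCleared N D) / ∏ i, (D i)²`: this quotient equals `R / E`
with `R` and `E` relatively prime. -/
def IsCharpolyNumerator {n : ℕ} (N D : Fin n → MvPolynomial (Fin n) K)
    (R : MvPolynomial (Fin n) (Polynomial K)) : Prop :=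
  ∃ E : MvPolynomial (Fin n) (Polynomial K), IsRelPrime R E ∧
    E * (charMatrixCleared N D).det = R * ∏ i, liftCoeff (D i) ^ 2

/-- The polynomial system for the fixed points and the eigenvalues. The unknowns are `t` (index
`0`) and `x₁, …, xₙ` (the indices `i.succ`), the coefficients are in `K[μ]`, and the equations are
`N i - xᵢ * D i = 0`, `1 - t * ∏ i, D i = 0` (no denominator vanishes) and `R = 0`. -/
noncomputable def fixedPointSystem {n : ℕ} (N D : Fin n → MvPolynomial (Fin n) K)
    (R : MvPolynomial (Fin n) (Polynomial K)) :
    Set (MvPolynomial (Fin (n + 1)) (Polynomial K)) :=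
  Set.range (fun i : Fin n =>
      MvPolynomial.rename Fin.succ (liftCoeff (N i - MvPolynomial.X i * D i))) ∪
    {1 - MvPolynomial.X 0 * MvPolynomial.rename Fin.succ (liftCoeff (∏ i, D i)),
      MvPolynomial.rename Fin.succ R}

end Rational

/-! ### Successive resultants -/

section Elimination

variable {K : Type} [Field K]

/-- The linear substitution `xᵢ ↦ ∑ j, M i j * xⱼ` of the unknowns. -/
noncomputable def changeUnknowns {m : ℕ} (M : Matrix (Fin m) (Fin m) K) :
    MvPolynomial (Fin m) (Polynomial K) →ₐ[Polynomial K] MvPolynomial (Fin m) (Polynomial K) :=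
  MvPolynomial.aeval fun i =>
    ∑ j, MvPolynomial.C (Polynomial.C (M i j)) * MvPolynomial.X j

/-- Elimination of the first unknown from a system `S`: the resultants, with respect to the first
unknown, of two `K`-linear combinations `A`, `B` of elements of `S` such that `A` involves the
first unknown, together with the `K`-linear combinations that do not involve it. -/
def eliminateFirst {m : ℕ} (S : Set (MvPolynomial (Fin (m + 1)) (Polynomial K))) :
    Set (MvPolynomial (Fin m) (Polynomial K)) :=
  {r | ∃ A ∈ Submodule.span K S, ∃ B ∈ Submodule.span K S,
      0 < (MvPolynomial.finSuccEquiv (Polynomial K) m A).natDegree ∧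
      r = Polynomial.resultant (MvPolynomial.finSuccEquiv (Polynomial K) m A)
        (MvPolynomial.finSuccEquiv (Polynomial K) m B)} ∪
  {r | MvPolynomial.rename Fin.succ r ∈ Submodule.span K S}

/-- `P ∈ K[μ]` is obtained from the system `S` by successive resultants: the `m` unknowns are
eliminated one after the other, an invertible linear change of the unknowns over `K` being allowed
before each elimination. -/
def ObtainedByResultants :
    (m : ℕ) → Set (MvPolynomial (Fin m) (Polynomial K)) → Polynomial K → Prop
  | 0, S, P => MvPolynomial.C P ∈ S
  | m + 1, S, P => ∃ M : Matrix (Fin (m + 1)) (Fin (m + 1)) K, IsUnit M.det ∧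
      ObtainedByResultants m (eliminateFirst (changeUnknowns M '' S)) P

end Elimination

end MeroInt

/-!
The eigenvalues are controlled through the action of `f` by composition on the algebra of functions
analytic at a fixed point `q`, filtered by the order of vanishing, and on its finite-dimensional
quotients, the jets.

*First integrals kill derivations.* Let `D` be a polynomial in the pullback `f^*` that is a
derivation of `k`-jets. An integral `G / H` is invariant under all iterates of `f`, so
`D G * H = G * D H` (`integral_aeval`). By the chain rule (`leibniz_eq_sum`), the values of `D` on
the coordinates solve a linear system whose matrix is the matrix of the differentials of the
integrals, up to denominators. Its determinant is not identically zero by functional independence,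
so it vanishes at `q` to some finite order `d`, and `D` is zero modulo functions vanishing to order
`k - d`, with `d` independent of `k` (`exists_order_bound`).

*Derivations from algebra endomorphisms.* If `μ` is an eigenvalue of `Df(q)` that is not a root of
unity, there is an additive character `χ` of `ℂˣ` with `χ μ ≠ 0`, as `ℂ` is divisible; the operator
that acts as `χ l` on the generalized eigenspace of `l` is a derivation and a polynomial in `f^*`
(`exists_leibniz_of_character`), and it is not zero in low order, a contradiction. Hence all
eigenvalues are `p`-th roots of unity for some `p`. Then the `p`-th iterate has a unipotent
differential and acts unipotently on jets; the logarithm of this action is again a derivation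
(`exists_leibniz_of_unipotent`), so it vanishes and the `p`-th iterate is the identity near `q`
(`exists_iterate_eventually_eq_id`). For an entire map it is then the identity everywhere, and
`X ^ p - 1` annihilates the eigenvalues at all fixed points. Moreover a map of finite order is
linearizable, so `1` is not an eigenvalue at an isolated fixed point
(`not_hasEigenvalue_one_of_iterate`).

*Elimination.* A resultant of `A` and `B` lies in the ideal they generate, so the polynomials
obtained by successive resultants vanish at the values of `μ` for which the system has a solution
(`ObtainedByResultants.map_eq_zero`). Conversely, a system without solutions over an algebraic
closure of `K(μ)` yields a nonzero polynomial (`exists_obtainedByResultants`): after a generic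
linear change some equation `A` has a constant leading coefficient, and over each point the
finitely many roots of `A` are avoided by a generic linear combination `B` of the equations, so
that the eliminated system has no solutions either.

*Rational maps.* Since `1` is not an eigenvalue, the Jacobian determinant of the fixed point
equations does not vanish at the fixed points in `ℂⁿ`. By the Nullstellensatz this persists over
every extension of `K` (`aeval_eq_zero_of_forall_complex`), so a fixed point over the algebraic
closure of `K(μ)` has coordinates algebraic over `K` (`isAlgebraic_of_jacobian_ne_zero`), and so are
the eigenvalues there; as `μ` is transcendental, the system has no solutions. When `K = ℚ`, the
minimal polynomial of an eigenvalue is a cyclotomic polynomial dividing the polynomial obtained,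
and only finitely many cyclotomic polynomials have a given degree.
-/

namespace MeroInt

/-! ### Jets of analytic functions -/

section Jets

variable {n : ℕ}

/-- The algebra of the functions on `ℂⁿ` that are analytic at `q`. Two functions with the same germ
at `q` are not identified; they are congruent modulo every `vanishingIdeal q k`. -/
def analyticAlg (q : Fin n → ℂ) : Subalgebra ℂ ((Fin n → ℂ) → ℂ) where
  carrier := {a | AnalyticAt ℂ a q}
  mul_mem' ha hb := AnalyticAt.mul ha hb
  add_mem' ha hb := AnalyticAt.add ha hb
  algebraMap_mem' _ := analyticAt_const

/-- The ideal of the functions that vanish at `q` to order at least `k`. -/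
def vanishingIdeal (q : Fin n → ℂ) (k : ℕ) : Ideal (analyticAlg q) where
  carrier := {a | a.1 =O[𝓝 q] fun x => ‖x - q‖ ^ k}
  add_mem' ha hb := Asymptotics.IsBigO.add ha hb
  zero_mem' := Asymptotics.isBigO_zero _ _
  smul_mem' c a ha := by
    have h1 : c.1 =O[𝓝 q] (fun _ => (1 : ℝ)) := c.2.continuousAt.isBigO_one ℝ
    have h2 := h1.mul (show a.1 =O[𝓝 q] fun x => ‖x - q‖ ^ k from ha)
    simp only [one_mul] at h2
    exact h2

theorem mem_vanishingIdeal {q : Fin n → ℂ} {k : ℕ} {a : analyticAlg q} :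
    a ∈ vanishingIdeal q k ↔ a.1 =O[𝓝 q] fun x => ‖x - q‖ ^ k := Iff.rfl

theorem vanishingIdeal_anti (q : Fin n → ℂ) {k l : ℕ} (h : k ≤ l) :
    vanishingIdeal q l ≤ vanishingIdeal q k := by
  intro a ha
  refine (mem_vanishingIdeal.1 ha).trans ?_
  refine Asymptotics.IsBigO.of_bound 1 ?_
  filter_upwards [Metric.ball_mem_nhds q one_pos] with x hx
  have hx' : ‖x - q‖ ≤ 1 := by
    rw [← dist_eq_norm]; exact (Metric.mem_ball.1 hx).le
  simp only [norm_pow, norm_norm, one_mul]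
  exact pow_le_pow_of_le_one (norm_nonneg _) hx' h

theorem mul_mem_vanishingIdeal {q : Fin n → ℂ} {k l : ℕ} {a b : analyticAlg q}
    (ha : a ∈ vanishingIdeal q k) (hb : b ∈ vanishingIdeal q l) :
    a * b ∈ vanishingIdeal q (k + l) := by
  have := (mem_vanishingIdeal.1 ha).mul (mem_vanishingIdeal.1 hb)
  rw [mem_vanishingIdeal]
  simpa only [pow_add] using! this

theorem vanishingIdeal_zero (q : Fin n → ℂ) : vanishingIdeal q 0 = ⊤ := by
  rw [eq_top_iff]
  intro a _
  rw [mem_vanishingIdeal]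
  simpa using a.2.continuousAt.isBigO_one ℝ

/-- The `j`-th coordinate centred at `q`. -/
def coordFn (q : Fin n → ℂ) (j : Fin n) : analyticAlg q :=
  ⟨fun x => x j - q j,
    ((ContinuousLinearMap.proj (R := ℂ) (φ := fun _ : Fin n => ℂ) j).analyticAt q).sub
      analyticAt_const⟩

/-- Polynomials in the coordinates centred at `q`. -/
noncomputable def polyFn (q : Fin n → ℂ) : MvPolynomial (Fin n) ℂ →ₐ[ℂ] analyticAlg q :=
  MvPolynomial.aeval (coordFn q)

theorem polyFn_apply (q : Fin n → ℂ) (P : MvPolynomial (Fin n) ℂ) (x : Fin n → ℂ) :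
    (polyFn q P).1 x = MvPolynomial.eval (x - q) P := by
  have : ((Pi.evalAlgHom ℂ (fun _ : Fin n → ℂ => ℂ) x).comp (analyticAlg q).val).comp (polyFn q)
      = MvPolynomial.aeval (x - q) := by
    apply MvPolynomial.algHom_ext
    intro i
    simp [polyFn, coordFn]
  have h := DFunLike.congr_fun this P
  simpa [MvPolynomial.aeval_eq_eval] using h

theorem coordFn_mem (q : Fin n → ℂ) (j : Fin n) : coordFn q j ∈ vanishingIdeal q 1 := by
  rw [mem_vanishingIdeal]
  refine Asymptotics.IsBigO.of_bound 1 (Eventually.of_forall fun x => ?_)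
  simpa [coordFn] using norm_le_pi_norm (x - q) j

theorem polyFn_mem_of_mem_pow {q : Fin n → ℂ} {k : ℕ} {P : MvPolynomial (Fin n) ℂ}
    (hP : P ∈ MvPolynomial.idealOfVars (Fin n) ℂ ^ k) : polyFn q P ∈ vanishingIdeal q k := by
  induction k generalizing P with
  | zero => rw [vanishingIdeal_zero]; trivial
  | succ k ih =>
    rw [pow_succ] at hP
    refine Submodule.mul_induction_on hP (fun a ha b hb => ?_) (fun a b ha hb => ?_)
    · rw [map_mul]
      refine mul_mem_vanishingIdeal (ih ha) ?_
      refine Submodule.span_induction ?_ ?_ ?_ ?_ hb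
      · rintro _ ⟨j, rfl⟩
        simpa [polyFn] using coordFn_mem q j
      · simp
      · intro x y _ _ hx hy; rw [map_add]; exact add_mem hx hy
      · intro c x _ hx; rw [smul_eq_mul, map_mul]; exact Ideal.mul_mem_left _ _ hx
    · rw [map_add]; exact add_mem ha hb

/-- On a line through `q` a homogeneous polynomial of degree `k` is a multiple of `t ^ k`, so it
cannot vanish to a higher order unless it is zero. -/
theorem homogeneous_eq_zero_of_polyFn_mem {q : Fin n → ℂ} {k : ℕ} {P : MvPolynomial (Fin n) ℂ}
    (hP : P.IsHomogeneous k) (h : polyFn q P ∈ vanishingIdeal q (k + 1)) : P = 0 := by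
  apply MvPolynomial.funext
  intro v
  rw [map_zero]
  have h1 : Tendsto (fun t : ℂ => q + t • v) (𝓝 0) (𝓝 q) := by
    have : Continuous fun t : ℂ => q + t • v := by fun_prop
    simpa using this.tendsto 0
  have h2 := (mem_vanishingIdeal.1 h).comp_tendsto h1
  have h3 : ((polyFn q P).1 ∘ fun t : ℂ => q + t • v) =
      fun t => t ^ k * MvPolynomial.eval v P := by
    ext t
    rw [Function.comp, polyFn_apply, add_sub_cancel_left]
    rw [MvPolynomial.eval_eq, MvPolynomial.eval_eq, Finset.mul_sum]
    refine Finset.sum_congr rfl fun d hd => ?_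
    have hd' := hP (MvPolynomial.mem_support_iff.1 hd)
    simp only [Pi.smul_apply, smul_eq_mul, mul_pow, Finset.prod_mul_distrib]
    rw [Finset.prod_pow_eq_pow_sum]
    have : ∑ i ∈ d.support, d i = k := by
      rw [← hd', Finsupp.weight_apply]; simp [Finsupp.sum]
    rw [this]; ring
  rw [h3] at h2
  have h4 : (fun t : ℂ => t ^ k * MvPolynomial.eval v P) =O[𝓝 0] fun t : ℂ => ‖t‖ ^ (k + 1) := by
    refine h2.trans ?_
    refine Asymptotics.IsBigO.of_bound (‖v‖ ^ (k + 1)) (Eventually.of_forall fun t => ?_)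
    simp [norm_smul, mul_pow, mul_comm]
  obtain ⟨C, hC⟩ := h4.bound
  by_contra hne
  have hpos : 0 < ‖MvPolynomial.eval v P‖ := norm_pos_iff.2 hne
  have h5 : ∀ᶠ t : ℂ in 𝓝[≠] 0, ‖MvPolynomial.eval v P‖ ≤ C * ‖t‖ := by
    filter_upwards [hC.filter_mono nhdsWithin_le_nhds, self_mem_nhdsWithin] with t ht ht0
    have htp : 0 < ‖t‖ ^ k := pow_pos (norm_pos_iff.2 ht0) _
    simp only [norm_mul, norm_pow, norm_norm, pow_succ] at ht
    have : ‖t‖ ^ k * ‖MvPolynomial.eval v P‖ ≤ ‖t‖ ^ k * (C * ‖t‖) := by linarith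
    exact le_of_mul_le_mul_left this htp
  have h6 : Tendsto (fun t : ℂ => C * ‖t‖) (𝓝[≠] 0) (𝓝 0) := by
    have : Continuous fun t : ℂ => C * ‖t‖ := by fun_prop
    simpa using (this.tendsto 0).mono_left nhdsWithin_le_nhds
  have := ge_of_tendsto h6 h5
  linarith

theorem sub_homogeneousComponent_mem {k : ℕ} {P : MvPolynomial (Fin n) ℂ}
    (hP : P ∈ MvPolynomial.idealOfVars (Fin n) ℂ ^ k) :
    P - MvPolynomial.homogeneousComponent k P ∈ MvPolynomial.idealOfVars (Fin n) ℂ ^ (k + 1) := by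
  classical
  rw [MvPolynomial.mem_pow_idealOfVars_iff'] at hP ⊢
  intro d hd
  rw [MvPolynomial.coeff_sub, MvPolynomial.coeff_homogeneousComponent]
  split_ifs with h
  · simp
  · rw [hP d (by omega), sub_zero]

theorem polyFn_mem_iff {q : Fin n → ℂ} {k : ℕ} {P : MvPolynomial (Fin n) ℂ} :
    polyFn q P ∈ vanishingIdeal q k ↔ P ∈ MvPolynomial.idealOfVars (Fin n) ℂ ^ k := by
  refine ⟨fun h => ?_, polyFn_mem_of_mem_pow⟩
  suffices ∀ i ≤ k, P ∈ MvPolynomial.idealOfVars (Fin n) ℂ ^ i from this k le_rfl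
  intro i
  induction i with
  | zero => intro _; simp
  | succ i ih =>
    intro hi
    have h1 := sub_homogeneousComponent_mem (ih (by omega))
    have h2 : polyFn q (MvPolynomial.homogeneousComponent i P) ∈ vanishingIdeal q (i + 1) := by
      have : MvPolynomial.homogeneousComponent i P =
          P - (P - MvPolynomial.homogeneousComponent i P) := by ring
      rw [this, map_sub]
      exact sub_mem (vanishingIdeal_anti q hi h) (polyFn_mem_of_mem_pow h1)
    rwa [homogeneous_eq_zero_of_polyFn_mem
      (MvPolynomial.homogeneousComponent_isHomogeneous i P) h2, sub_zero] at h1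

theorem exists_eval_eq_multilinear {i : ℕ}
    (p : ContinuousMultilinearMap ℂ (fun _ : Fin i => (Fin n → ℂ)) ℂ) :
    ∃ P : MvPolynomial (Fin n) ℂ, ∀ y, MvPolynomial.eval y P = p fun _ => y := by
  refine ⟨∑ r : Fin i → Fin n, MvPolynomial.C (p fun s => Pi.single (r s) 1) *
    ∏ s, MvPolynomial.X (r s), fun y => ?_⟩
  have hy : (fun _ : Fin i => y) = fun _ => ∑ j, y j • (Pi.single j (1 : ℂ) : Fin n → ℂ) := by
    funext _
    exact pi_eq_sum_univ' y
  conv_rhs => rw [hy]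
  rw [ContinuousMultilinearMap.map_sum]
  simp only [map_sum, map_mul, MvPolynomial.eval_C, map_prod, MvPolynomial.eval_X]
  refine Finset.sum_congr rfl fun r _ => ?_
  rw [ContinuousMultilinearMap.map_smul_univ, smul_eq_mul, mul_comm]

/-- Taylor's formula. -/
theorem exists_polyFn_sub_mem {q : Fin n → ℂ} (a : analyticAlg q) (k : ℕ) :
    ∃ P, a - polyFn q P ∈ vanishingIdeal q k := by
  obtain ⟨p, hp⟩ := a.2
  choose P hP using fun i => exists_eval_eq_multilinear (p i)
  refine ⟨∑ i ∈ Finset.range k, P i, ?_⟩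
  rw [mem_vanishingIdeal]
  have h1 := hp.isBigO_sub_partialSum_pow k
  have h2 : Tendsto (fun x => x - q) (𝓝 q) (𝓝 0) := by
    have : Continuous fun x => x - q := by fun_prop
    simpa using this.tendsto q
  refine (h1.comp_tendsto h2).congr' (Eventually.of_forall fun x => ?_)
    (Eventually.of_forall fun x => rfl)
  simp only [Function.comp, add_sub_cancel, FormalMultilinearSeries.partialSum]
  change _ = a.1 x - (polyFn q _).1 x
  rw [polyFn_apply, map_sum]
  simp [hP]

theorem eventually_eq_zero_of_forall_mem {q : Fin n → ℂ} {a : analyticAlg q}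
    (h : ∀ k, a ∈ vanishingIdeal q k) : ∀ᶠ x in 𝓝 q, a.1 x = 0 := by
  obtain ⟨p, hp⟩ := a.2
  have h2 : Tendsto (fun y => q + y) (𝓝 0) (𝓝 q) := by
    have : Continuous fun y => q + y := by fun_prop
    simpa using this.tendsto 0
  have hO : ∀ k, (fun y => a.1 (q + y)) =O[𝓝 0] fun y => ‖y‖ ^ k := by
    intro k
    refine ((mem_vanishingIdeal.1 (h k)).comp_tendsto h2).congr_right fun y => ?_
    simp
  have hz : ∀ i, ∀ y, (p i fun _ => y) = 0 := by
    intro i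
    induction i using Nat.strong_induction_on with
    | _ i ih =>
      intro y
      refine Asymptotics.IsBigO.continuousMultilinearMap_apply_eq_zero ?_ y
      have h3 := (hO (i + 1)).sub (hp.isBigO_sub_partialSum_pow (i + 1))
      refine h3.congr_left fun y => ?_
      rw [sub_sub_cancel, FormalMultilinearSeries.partialSum, Finset.sum_range_succ,
        Finset.sum_eq_zero, zero_add]
      intro j hj
      exact ih j (Finset.mem_range.1 hj) y
  have h4 := hp.eventually_hasSum_sub
  filter_upwards [h4] with x hx
  have : (fun i => p i fun _ => x - q) = fun _ => 0 := by
    funext i; exact hz i _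
  rw [this] at hx
  exact hx.unique hasSum_zero

theorem mem_pow_idealOfVars_iff_order {k : ℕ} {P : MvPolynomial (Fin n) ℂ} :
    P ∈ MvPolynomial.idealOfVars (Fin n) ℂ ^ k ↔
      (k : ℕ∞) ≤ (P : MvPowerSeries (Fin n) ℂ).order := by
  rw [MvPolynomial.mem_pow_idealOfVars_iff']
  constructor
  · intro h
    apply MvPowerSeries.nat_le_order
    intro d hd
    simpa using h d hd
  · intro h d hd
    have := MvPowerSeries.coeff_of_lt_order (f := (P : MvPowerSeries (Fin n) ℂ)) (d := d)
      (lt_of_lt_of_le (by exact_mod_cast hd) h)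
    simpa using this

/-- The order of vanishing of a product is the sum of the orders. -/
theorem mem_vanishingIdeal_of_mul_mem {q : Fin n → ℂ} {d k : ℕ} {a b : analyticAlg q}
    (ha : a ∉ vanishingIdeal q (d + 1)) (hab : a * b ∈ vanishingIdeal q (k + d)) :
    b ∈ vanishingIdeal q k := by
  obtain ⟨P, hP⟩ := exists_polyFn_sub_mem a (k + d + 1)
  obtain ⟨Q, hQ⟩ := exists_polyFn_sub_mem b (k + d)
  have h1 : polyFn q (P * Q) ∈ vanishingIdeal q (k + d) := by
    have : polyFn q (P * Q) = a * b - ((a - polyFn q P) * b + polyFn q P * (b - polyFn q Q)) := by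
      rw [map_mul]; ring
    rw [this]
    exact sub_mem hab (add_mem (Ideal.mul_mem_right _ _ (vanishingIdeal_anti q (by omega) hP))
      (Ideal.mul_mem_left _ _ hQ))
  have h2 : polyFn q P ∉ vanishingIdeal q (d + 1) := by
    intro h
    apply ha
    have := add_mem (vanishingIdeal_anti q (show d + 1 ≤ k + d + 1 by omega) hP) h
    simpa using this
  suffices h3 : polyFn q Q ∈ vanishingIdeal q k by
    have := add_mem (vanishingIdeal_anti q (show k ≤ k + d by omega) hQ) h3
    simpa using this
  rw [polyFn_mem_iff, mem_pow_idealOfVars_iff_order] at h1 h2 ⊢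
  rw [MvPolynomial.coe_mul, MvPowerSeries.order_mul] at h1
  by_contra hlt
  rw [not_le] at h2 hlt
  generalize (P : MvPowerSeries (Fin n) ℂ).order = u at *
  generalize (Q : MvPowerSeries (Fin n) ℂ).order = v at *
  lift u to ℕ using h2.ne_top
  lift v to ℕ using hlt.ne_top
  norm_cast at *
  omega

/-- The partial derivative in the `j`-th coordinate. -/
noncomputable def partialFn (q : Fin n → ℂ) (j : Fin n) (a : analyticAlg q) : analyticAlg q :=
  ⟨fun x => fderiv ℂ a.1 x (Pi.single j 1),
    ((ContinuousLinearMap.apply ℂ ℂ (Pi.single j (1 : ℂ) : Fin n → ℂ)).analyticAt _).comp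
      a.2.fderiv⟩

theorem partialFn_sub (q : Fin n → ℂ) (j : Fin n) (a b : analyticAlg q) (k : ℕ) :
    partialFn q j (a - b) - (partialFn q j a - partialFn q j b) ∈ vanishingIdeal q k := by
  rw [mem_vanishingIdeal]
  refine (Asymptotics.isBigO_zero _ _).congr' ?_ EventuallyEq.rfl
  filter_upwards [a.2.eventually_analyticAt, b.2.eventually_analyticAt] with x ha hb
  change _ = fderiv ℂ (a.1 - b.1) x _ - (fderiv ℂ a.1 x _ - fderiv ℂ b.1 x _)
  rw [fderiv_sub ha.differentiableAt hb.differentiableAt]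
  simp

/-- Cauchy's estimate: differentiation lowers the order of vanishing by at most one. -/
theorem partialFn_mem {q : Fin n → ℂ} {k : ℕ} {a : analyticAlg q} (j : Fin n)
    (ha : a ∈ vanishingIdeal q (k + 1)) : partialFn q j a ∈ vanishingIdeal q k := by
  rw [mem_vanishingIdeal] at ha ⊢
  obtain ⟨C, hC⟩ := ha.bound
  obtain ⟨ε, hε, hball⟩ := Metric.eventually_nhds_iff_ball.1 (hC.and a.2.eventually_analyticAt)
  have hC0 : 0 ≤ |C| := abs_nonneg C
  have key : ∀ x ∈ Metric.ball q (ε / 2), x ≠ q →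
      ‖(partialFn q j a).1 x‖ ≤ |C| * 2 ^ (k + 1) * ‖‖x - q‖ ^ k‖ := by
    intro x hx hxq
    set e : Fin n → ℂ := Pi.single j 1 with he
    have hen : ‖e‖ = 1 := by rw [he, Pi.norm_single]; simp
    set r := ‖x - q‖ with hr
    have hrp : 0 < r := norm_pos_iff.2 (sub_ne_zero.2 hxq)
    have hxr : r < ε / 2 := by rwa [hr, ← dist_eq_norm]
    have hmem : ∀ ζ : ℂ, ‖ζ‖ ≤ r → x + ζ • e ∈ Metric.ball q ε ∧ ‖x + ζ • e - q‖ ≤ 2 * r := by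
      intro ζ hζ
      have : ‖x + ζ • e - q‖ ≤ 2 * r := by
        calc ‖x + ζ • e - q‖ = ‖(x - q) + ζ • e‖ := by congr 1; abel
          _ ≤ ‖x - q‖ + ‖ζ • e‖ := norm_add_le _ _
          _ ≤ 2 * r := by rw [norm_smul, hen]; linarith
      refine ⟨?_, this⟩
      rw [Metric.mem_ball, dist_eq_norm]; linarith
    have hline : ∀ ζ : ℂ, HasDerivAt (fun ζ : ℂ => x + ζ • e) e ζ := by
      intro ζ
      simpa using ((hasDerivAt_id ζ).smul_const e).const_add x
    have hd : ∀ ζ : ℂ, ‖ζ‖ ≤ r →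
        HasDerivAt (fun ζ : ℂ => a.1 (x + ζ • e)) (fderiv ℂ a.1 (x + ζ • e) e) ζ := by
      intro ζ hζ
      exact ((hball _ (hmem ζ hζ).1).2.differentiableAt.hasFDerivAt).comp_hasDerivAt ζ (hline ζ)
    have hdiff : DiffContOnCl ℂ (fun ζ : ℂ => a.1 (x + ζ • e)) (Metric.ball 0 r) := by
      apply DifferentiableOn.diffContOnCl
      rw [closure_ball _ hrp.ne']
      intro ζ hζ
      exact (hd ζ (by simpa using hζ)).differentiableAt.differentiableWithinAt
    have hbd : ∀ ζ ∈ Metric.sphere (0 : ℂ) r, ‖a.1 (x + ζ • e)‖ ≤ |C| * (2 * r) ^ (k + 1) := by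
      intro ζ hζ
      have hζ' : ‖ζ‖ ≤ r := by simpa using (mem_sphere_iff_norm.1 hζ).le
      have h1 := (hball _ (hmem ζ hζ').1).1
      simp only [norm_pow, norm_norm] at h1
      refine h1.trans ?_
      refine mul_le_mul (le_abs_self C) ?_ (by positivity) hC0
      exact pow_le_pow_left₀ (norm_nonneg _) (hmem ζ hζ').2 _
    have h2 := Complex.norm_deriv_le_of_forall_mem_sphere_norm_le hrp hdiff hbd
    rw [(hd 0 (by simpa using hrp.le)).deriv] at h2
    simp only [zero_smul, add_zero] at h2
    change ‖fderiv ℂ a.1 x e‖ ≤ _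
    refine h2.trans (le_of_eq ?_)
    rw [norm_pow, norm_norm, mul_pow, pow_succ r k]
    rw [← hr]
    field_simp
  rcases Nat.eq_zero_or_pos k with rfl | hk
  · have := vanishingIdeal_zero q
    have h : partialFn q j a ∈ vanishingIdeal q 0 := by rw [this]; trivial
    exact h
  -- at the point `q` itself the estimate says that the derivative vanishes, by continuity
  refine Asymptotics.IsBigO.of_bound (|C| * 2 ^ (k + 1)) ?_
  filter_upwards [Metric.ball_mem_nhds q (half_pos hε)] with x hx
  by_cases hxq : x = q
  · subst hxq
    have hcont : ContinuousAt (partialFn x j a).1 x := (partialFn x j a).2.continuousAt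
    rcases n with _ | n
    · exact j.elim0
    have h3 : ∀ᶠ y in 𝓝[≠] x, ‖(partialFn x j a).1 y‖ ≤ |C| * 2 ^ (k + 1) * ‖‖y - x‖ ^ k‖ := by
      filter_upwards [nhdsWithin_le_nhds (Metric.ball_mem_nhds x (half_pos hε)),
        self_mem_nhdsWithin] with y hy hyx
      exact key y hy hyx
    have h4 : Tendsto (fun y => |C| * 2 ^ (k + 1) * ‖‖y - x‖ ^ k‖) (𝓝[≠] x)
        (𝓝 (|C| * 2 ^ (k + 1) * ‖‖x - x‖ ^ k‖)) := by
      have : Continuous fun y : Fin (n + 1) → ℂ => |C| * 2 ^ (k + 1) * ‖‖y - x‖ ^ k‖ := by fun_prop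
      exact (this.tendsto x).mono_left nhdsWithin_le_nhds
    have : (𝓝[≠] x).NeBot := Module.punctured_nhds_neBot ℂ _ x
    exact le_of_tendsto_of_tendsto (hcont.norm.tendsto.mono_left nhdsWithin_le_nhds) h4 h3
  · exact key x hx hxq

end Jets

end MeroInt
namespace MeroInt

/-! ### Derivations that are polynomials in an algebra endomorphism -/

section Algebra

open Polynomial

variable {V : Type*} [CommRing V] [Algebra ℂ V]

/-- Generalized eigenvectors of an algebra endomorphism multiply like the eigenvalues, by the
identity `(T - l m) (a b) = (T - l) a * T b + l a * (T - m) b`. -/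
theorem pow_sub_smul_mul_eq_zero (T : V →ₐ[ℂ] V) {l m : ℂ} (i j : ℕ) {a b : V}
    (ha : ((T.toLinearMap - l • (1 : Module.End ℂ V)) ^ i) a = 0)
    (hb : ((T.toLinearMap - m • (1 : Module.End ℂ V)) ^ j) b = 0) :
    ((T.toLinearMap - (l * m) • (1 : Module.End ℂ V)) ^ (i + j)) (a * b) = 0 := by
  induction h : i + j generalizing i j a b with
  | zero =>
    obtain rfl : i = 0 := by omega
    have : a = 0 := by simpa using ha
    simp [this]
  | succ k ih =>
    rcases i with _ | i
    · have : a = 0 := by simpa using ha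
      simp [this]
    rcases j with _ | j
    · have : b = 0 := by simpa using hb
      simp [this]
    rw [pow_succ, Module.End.mul_apply] at ha hb ⊢
    have hstep : (T.toLinearMap - (l * m) • (1 : Module.End ℂ V)) (a * b) =
        (T.toLinearMap - l • (1 : Module.End ℂ V)) a * T b +
          (l • a) * (T.toLinearMap - m • (1 : Module.End ℂ V)) b := by
      have e : ∀ (c : ℂ) (x : V), (T.toLinearMap - c • (1 : Module.End ℂ V)) x =
          T x - algebraMap ℂ V c * x := by
        intro c x
        rw [← Algebra.smul_def]
        rfl
      rw [e, e, e, map_mul, map_mul, Algebra.smul_def]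
      ring
    have hTb : ((T.toLinearMap - m • (1 : Module.End ℂ V)) ^ (j + 1)) (T b) = 0 := by
      have hc : Commute ((T.toLinearMap - m • (1 : Module.End ℂ V)) ^ (j + 1)) T.toLinearMap :=
        ((Commute.refl _).sub_left ((Commute.one_left _).smul_left _)).pow_left _
      have := LinearMap.congr_fun hc.eq b
      simp only [Module.End.mul_apply, AlgHom.toLinearMap_apply] at this
      rw [this, pow_succ, Module.End.mul_apply, hb, map_zero]
    have hla : ((T.toLinearMap - l • (1 : Module.End ℂ V)) ^ (i + 1)) (l • a) = 0 := by
      rw [map_smul, pow_succ, Module.End.mul_apply, ha, smul_zero]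
    rw [hstep, map_add, ih i (j + 1) ha hTb (by omega), ih (i + 1) j hla hb (by omega), add_zero]

/-- An additive character `χ` of `ℂˣ` gives a derivation acting as `χ l` on the generalized
eigenspace of `T` for the eigenvalue `l`. It is a polynomial in `T` by the Chinese remainder
theorem, and it is a derivation because generalized eigenspaces multiply like their eigenvalues. -/
theorem exists_leibniz_of_character [FiniteDimensional ℂ V] (T : V →ₐ[ℂ] V)
    (hT : Function.Injective T) (χ : ℂ → ℂ)
    (hχ : ∀ l m, l ≠ 0 → m ≠ 0 → χ (l * m) = χ l + χ m) :
    ∃ p : ℂ[X], (∀ l, Module.End.HasEigenvalue T.toLinearMap l → p.eval l = χ l) ∧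
      ∀ a b, aeval T.toLinearMap p (a * b) =
        aeval T.toLinearMap p a * b + a * aeval T.toLinearMap p b := by
  classical
  set N := Module.finrank ℂ V
  set s : Finset ℂ := (minpoly ℂ T.toLinearMap).roots.toFinset
  have hs : ∀ l, Module.End.HasEigenvalue T.toLinearMap l → l ∈ s := by
    intro l hl
    rw [Multiset.mem_toFinset, mem_roots (minpoly.ne_zero (Algebra.IsIntegral.isIntegral _))]
    exact Module.End.hasEigenvalue_iff_isRoot.1 hl
  obtain ⟨p, hp⟩ := IsDedekindDomain.exists_forall_sub_mem_ideal (R := ℂ[X]) (s := s)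
    (fun l => Ideal.span {X - C l}) (fun _ => N + 1)
    (fun l _ => by
      rw [Ideal.prime_iff_isPrime (by simpa using X_sub_C_ne_zero l),
        Ideal.span_singleton_prime (X_sub_C_ne_zero l)]
      exact prime_X_sub_C l)
    (fun l _ m _ hlm h => hlm (by
      have h1 : X - C m ∈ Ideal.span {X - C l} := by
        rw [h]; exact Ideal.mem_span_singleton_self _
      have := dvd_iff_isRoot.1 (Ideal.mem_span_singleton.1 h1)
      simpa [IsRoot, sub_eq_zero] using this))
    (fun l => C (χ l))
  have hdvd : ∀ l, Module.End.HasEigenvalue T.toLinearMap l →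
      (X - C l) ^ (N + 1) ∣ p - C (χ l) := by
    intro l hl
    have := hp l (hs l hl)
    rwa [Ideal.span_singleton_pow, Ideal.mem_span_singleton] at this
  have hact : ∀ l, ∀ a ∈ Module.End.maxGenEigenspace T.toLinearMap l,
      aeval T.toLinearMap p a = χ l • a := by
    intro l a ha
    by_cases hl : Module.End.HasEigenvalue T.toLinearMap l
    · obtain ⟨r, hr⟩ := hdvd l hl
      rw [Module.End.maxGenEigenspace_eq_genEigenspace_finrank,
        Module.End.mem_genEigenspace_nat, LinearMap.mem_ker] at ha
      have h1 : p = r * (X - C l) ^ (N + 1) + C (χ l) := by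
        rw [mul_comm, ← hr]; ring
      rw [h1, map_add, map_mul, map_pow, map_sub, aeval_X, aeval_C, aeval_C, LinearMap.add_apply,
        Module.End.mul_apply, pow_succ', Module.End.mul_apply,
        Algebra.algebraMap_eq_smul_one, Algebra.algebraMap_eq_smul_one, ha]
      simp
    · have : Module.End.maxGenEigenspace T.toLinearMap l = ⊥ := by
        by_contra hne
        apply hl
        rw [Module.End.maxGenEigenspace_eq_genEigenspace_finrank] at hne
        exact Module.End.hasEigenvalue_of_hasGenEigenvalue (k := N) hne
      rw [this, Submodule.mem_bot] at ha
      simp [ha]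
  refine ⟨p, fun l hl => ?_, fun a b => ?_⟩
  · obtain ⟨r, hr⟩ := hdvd l hl
    have := congrArg (eval l) hr
    simp only [eval_sub, eval_C, eval_mul, eval_pow, eval_X, sub_self] at this
    rw [zero_pow (by omega), zero_mul, sub_eq_zero] at this
    exact this
  · have htop : ∀ a : V, a ∈ ⨆ l, Module.End.maxGenEigenspace T.toLinearMap l := by
      intro a; rw [Module.End.iSup_maxGenEigenspace_eq_top]; trivial
    have h0 : ∀ a, a ∈ Module.End.maxGenEigenspace T.toLinearMap 0 → a = 0 := by
      intro a ha
      rw [Module.End.mem_maxGenEigenspace] at ha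
      obtain ⟨k, hk⟩ := ha
      rw [zero_smul, sub_zero] at hk
      have hinj : Function.Injective (T.toLinearMap ^ k) := by
        rw [Module.End.coe_pow]; exact Function.Injective.iterate hT k
      exact hinj (by rw [hk, map_zero])
    refine Submodule.iSup_induction _ (motive := fun a => aeval T.toLinearMap p (a * b) =
      aeval T.toLinearMap p a * b + a * aeval T.toLinearMap p b) (htop a) (fun l a ha => ?_)
      (by simp) ?_
    · refine Submodule.iSup_induction _ (motive := fun b => aeval T.toLinearMap p (a * b) =
        aeval T.toLinearMap p a * b + a * aeval T.toLinearMap p b) (htop b) (fun m b hb => ?_)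
        (by simp) ?_
      · by_cases hl : l = 0
        · subst hl; rw [h0 a ha]; simp
        by_cases hm : m = 0
        · subst hm; rw [h0 b hb]; simp
        have hab : a * b ∈ Module.End.maxGenEigenspace T.toLinearMap (l * m) := by
          rw [Module.End.mem_maxGenEigenspace] at ha hb ⊢
          obtain ⟨i, hi⟩ := ha
          obtain ⟨j, hj⟩ := hb
          exact ⟨i + j, pow_sub_smul_mul_eq_zero T i j hi hj⟩
        rw [hact _ _ hab, hact _ _ ha, hact _ _ hb, hχ l m hl hm]
        simp only [add_smul, smul_mul_assoc, mul_smul_comm]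
      · intro x y hx hy
        rw [mul_add, map_add, hx, hy, map_add]; ring
    · intro x y hx hy
      rw [add_mul, map_add, hx, hy, map_add]; ring

/-- Polynomials over a `ℂ`-algebra, which may have zero divisors, are determined by their values at
the natural numbers, because the nonzero natural numbers are invertible. -/
theorem polynomial_eq_zero_of_eval_natCast (p : V[X]) (h : ∀ N : ℕ, p.eval (N : V) = 0) :
    p = 0 := by
  suffices ∀ d, ∀ p : V[X], p.natDegree ≤ d → (∀ N : ℕ, p.eval (N : V) = 0) → p = 0 from
    this _ p le_rfl h
  intro d
  induction d with
  | zero =>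
    intro p hp h
    rw [eq_C_of_natDegree_le_zero hp] at h ⊢
    have := h 0
    rw [eval_C] at this
    rw [this, C_0]
  | succ d ih =>
    intro p hp h
    have h0 : p.coeff 0 = 0 := by
      have := h 0
      rwa [Nat.cast_zero, ← coeff_zero_eq_eval_zero] at this
    obtain ⟨r, rfl⟩ := X_dvd_iff.2 h0
    have hr : taylor 1 r = 0 := by
      apply ih
      · rw [natDegree_taylor]
        by_cases hr : r = 0
        · simp [hr]
        · have : Nontrivial V := by
            by_contra hV
            rw [not_nontrivial_iff_subsingleton] at hV
            exact hr (Subsingleton.elim _ _)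
          rw [natDegree_X_mul hr] at hp
          omega
      · intro N
        have h1 := h (N + 1)
        rw [eval_mul, eval_X] at h1
        have hu : IsUnit ((N + 1 : ℕ) : V) := by
          have h2 : IsUnit ((N + 1 : ℕ) : ℂ) := by
            rw [isUnit_iff_ne_zero]; exact_mod_cast Nat.succ_ne_zero N
          simpa using h2.map (algebraMap ℂ V)
        rw [taylor_eval]
        have := (hu.mul_right_eq_zero).1 h1
        simpa using this
    have : r = 0 := taylor_injective 1 (by rw [hr, map_zero])
    rw [this, mul_zero]

/-- A truncated series in `T - 1` that starts like the logarithm is `T - 1` times a factor that is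
invertible when `T` is unipotent. -/
theorem exists_sum_eq_mul_one_add (m : ℕ) (c : ℕ → ℂ) (h0 : c 0 = 0) (h1 : c 1 = 1) :
    ∃ w : ℂ[X], ∑ i ∈ Finset.range (m + 2), C (c i) * (X - 1) ^ i =
      (X - 1) * (1 + (X - 1) * w) := by
  refine ⟨∑ i ∈ Finset.range m, C (c (i + 2)) * (X - 1) ^ i, ?_⟩
  have h : ∀ i, C (c (i + 1 + 1)) * (X - 1 : ℂ[X]) ^ (i + 1 + 1) =
      (X - 1) * ((X - 1) * (C (c (i + 2)) * (X - 1) ^ i)) := fun i => by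
    rw [pow_succ, pow_succ]; ring
  rw [Finset.sum_range_succ', Finset.sum_range_succ', zero_add, h0, h1, Finset.sum_congr rfl
    (fun i _ => h i), ← Finset.mul_sum, ← Finset.mul_sum, map_zero, map_one]
  ring

/-- The logarithm of a unipotent algebra endomorphism `T`. It is a derivation since it is the
derivative at `0` of `N ↦ T ^ N`, which is polynomial in `N` and multiplicative. -/
theorem exists_leibniz_of_unipotent (T : V →ₐ[ℂ] V) {m : ℕ}
    (hT : (T.toLinearMap - 1) ^ m = 0) :
    ∃ p r : ℂ[X], (∀ a b, aeval T.toLinearMap p (a * b) =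
        aeval T.toLinearMap p a * b + a * aeval T.toLinearMap p b) ∧
      T.toLinearMap - 1 = aeval T.toLinearMap r * aeval T.toLinearMap p := by
  set L : Module.End ℂ V := T.toLinearMap - 1
  have hTL : T.toLinearMap = L + 1 := by simp [L]
  have hL : ∀ i, m + 2 ≤ i → L ^ i = 0 := fun i hi => by
    obtain ⟨j, rfl⟩ := Nat.exists_eq_add_of_le (show m ≤ i by omega)
    rw [pow_add, hT, zero_mul]
  -- `binom i` is the polynomial `N ↦ N.choose i`
  set binom : ℕ → ℂ[X] := fun i => C ((i.factorial : ℂ)⁻¹) * descPochhammer ℂ i with hbinom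
  have hbe : ∀ i N : ℕ, (binom i).eval (N : ℂ) = (N.choose i : ℂ) := by
    intro i N
    rw [hbinom]
    simp only [eval_mul, eval_C, descPochhammer_eval_eq_descFactorial]
    rw [Nat.descFactorial_eq_factorial_mul_choose, Nat.cast_mul, inv_mul_cancel_left₀]
    exact_mod_cast Nat.factorial_ne_zero i
  set P : V → V[X] := fun a =>
    ∑ i ∈ Finset.range (m + 2), C ((L ^ i) a) * (binom i).map (algebraMap ℂ V) with hP
  have hPe : ∀ a (N : ℕ), (P a).eval (N : V) = (T.toLinearMap ^ N) a := by
    intro a N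
    have h1 : (T.toLinearMap ^ N) a = ∑ i ∈ Finset.range (N + 1), (N.choose i : ℂ) • (L ^ i) a := by
      rw [hTL, (Commute.one_right L).add_pow, LinearMap.sum_apply]
      refine Finset.sum_congr rfl fun i _ => ?_
      rw [one_pow, mul_one, ← nsmul_eq_mul', LinearMap.smul_apply, Nat.cast_smul_eq_nsmul]
    have h2 : (P a).eval (N : V) = ∑ i ∈ Finset.range (m + 2), (N.choose i : ℂ) • (L ^ i) a := by
      rw [hP, eval_finsetSum]
      refine Finset.sum_congr rfl fun i _ => ?_
      rw [eval_mul, eval_C, ← hbe, ← map_natCast (algebraMap ℂ V), eval_map_algebraMap,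
        aeval_algebraMap_apply, coe_aeval_eq_eval, Algebra.smul_def, mul_comm]
    rw [h1, h2, Finset.sum_subset (Finset.range_mono (show m + 2 ≤ N + 1 + (m + 2) by omega)),
      Finset.sum_subset (s₁ := Finset.range (N + 1))
        (Finset.range_mono (show N + 1 ≤ N + 1 + (m + 2) by omega))]
    · intro i _ hi
      rw [Nat.choose_eq_zero_of_lt (by simpa using hi), Nat.cast_zero, zero_smul]
    · intro i _ hi
      rw [hL i (by simpa using hi), LinearMap.zero_apply, smul_zero]
  have hmul : ∀ a b, P (a * b) = P a * P b := by
    intro a b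
    rw [← sub_eq_zero]
    apply polynomial_eq_zero_of_eval_natCast
    intro N
    rw [eval_sub, eval_mul, hPe, hPe, hPe]
    simp only [Module.End.coe_pow]
    have : ∀ c, (⇑T.toLinearMap)^[N] c = (T ^ N) c := by
      intro c; rw [AlgHom.coe_pow]; rfl
    rw [this, this, this, map_mul, sub_self]
  set p : ℂ[X] := ∑ i ∈ Finset.range (m + 2), C ((binom i).derivative.eval 0) * (X - 1) ^ i with hp
  have hpa : ∀ a, aeval T.toLinearMap p a = (P a).derivative.eval 0 := by
    intro a
    rw [hp, hP]
    simp only [map_sum, map_mul, aeval_C, map_pow, map_sub, aeval_X, map_one, LinearMap.sum_apply,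
      derivative_mul, derivative_C, zero_mul, zero_add, derivative_map,
      eval_finsetSum, eval_mul, eval_C]
    refine Finset.sum_congr rfl fun i _ => ?_
    rw [Module.End.mul_apply, Module.algebraMap_end_apply, Algebra.smul_def, mul_comm]
    congr 1
    rw [← map_zero (algebraMap ℂ V), eval_map_algebraMap, aeval_algebraMap_apply, coe_aeval_eq_eval]
  have hP0 : ∀ a, (P a).eval 0 = a := by
    intro a
    have := hPe a 0
    simpa using this
  obtain ⟨w, hw⟩ : ∃ w : ℂ[X], p = (X - 1) * (1 + (X - 1) * w) := by
    have e0 : (binom 0).derivative.eval 0 = 0 := by simp [hbinom]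
    have e1 : (binom 1).derivative.eval 0 = 1 := by simp [hbinom]
    exact exists_sum_eq_mul_one_add m _ e0 e1
  have hcop : IsCoprime (1 + (X - 1) * w) ((X - 1 : ℂ[X]) ^ m) := by
    apply IsCoprime.pow_right
    exact ⟨1, -w, by ring⟩
  obtain ⟨u, v, huv⟩ := hcop
  refine ⟨p, u, fun a b => ?_, ?_⟩
  · rw [hpa, hpa, hpa, hmul, derivative_mul, eval_add, eval_mul, eval_mul, hP0, hP0]
  · have h1 : (X - 1 : ℂ[X]) = u * p + v * (X - 1) * (X - 1) ^ m := by
      rw [hw]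
      linear_combination (-(X - 1 : ℂ[X])) * huv
    have h2 := congrArg (aeval T.toLinearMap) h1
    simp only [map_add, map_mul, map_sub, map_pow, aeval_X, map_one] at h2
    rw [hT, mul_zero, add_zero] at h2
    exact h2

end Algebra

end MeroInt
namespace MeroInt

/-! ### Composition with an analytic map that fixes a point -/

section Pullback

open Polynomial

variable {n : ℕ} {q : Fin n → ℂ} {f : (Fin n → ℂ) → (Fin n → ℂ)}

/-- Composition with `f`, an endomorphism of the algebra of functions analytic at the fixed point
`q` of `f`. -/
def pullback (hf : AnalyticAt ℂ f q) (hq : f q = q) : analyticAlg q →ₐ[ℂ] analyticAlg q where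
  toFun a := ⟨a.1 ∘ f, AnalyticAt.comp (by rw [hq]; exact a.2) hf⟩
  map_one' := rfl
  map_mul' _ _ := rfl
  map_zero' := rfl
  map_add' _ _ := rfl
  commutes' _ := rfl

variable (hf : AnalyticAt ℂ f q) (hq : f q = q)

theorem pullback_apply (a : analyticAlg q) (x : Fin n → ℂ) : (pullback hf hq a).1 x = a.1 (f x) :=
  rfl

theorem tendsto_of_fixed {q : Fin n → ℂ} {f : (Fin n → ℂ) → (Fin n → ℂ)} (hf : AnalyticAt ℂ f q)
    (hq : f q = q) : Tendsto f (𝓝 q) (𝓝 q) := by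
  have := hf.continuousAt.tendsto
  rwa [hq] at this

theorem isBigO_pow_of_fixed {g : (Fin n → ℂ) → (Fin n → ℂ)} (hg : DifferentiableAt ℂ g q)
    (hq : g q = q) {a : (Fin n → ℂ) → ℂ} {k : ℕ} (ha : a =O[𝓝 q] fun x => ‖x - q‖ ^ k) :
    (a ∘ g) =O[𝓝 q] fun x => ‖x - q‖ ^ k := by
  have ht : Tendsto g (𝓝 q) (𝓝 q) := by
    have := hg.continuousAt.tendsto
    rwa [hq] at this
  refine (ha.comp_tendsto ht).trans ?_
  have h1 : (fun x => g x - q) =O[𝓝 q] fun x => x - q := by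
    have := hg.isBigO_sub
    rwa [hq] at this
  exact h1.norm_norm.pow k

theorem pullback_mem {a : analyticAlg q} {k : ℕ} (ha : a ∈ vanishingIdeal q k) :
    pullback hf hq a ∈ vanishingIdeal q k :=
  isBigO_pow_of_fixed hf.differentiableAt hq ha

/-- The pullback by a local diffeomorphism reflects orders of vanishing, as one sees by composing
with a local inverse. -/
theorem mem_of_pullback_mem (hdet : (fderiv ℂ f q).det ≠ 0) {a : analyticAlg q} {k : ℕ}
    (ha : pullback hf hq a ∈ vanishingIdeal q k) : a ∈ vanishingIdeal q k := by
  have hs : HasStrictFDerivAt f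
      ((fderiv ℂ f q).toContinuousLinearEquivOfDetNeZero hdet :
        (Fin n → ℂ) →L[ℂ] (Fin n → ℂ)) q := by
    rw [ContinuousLinearMap.coe_toContinuousLinearEquivOfDetNeZero]
    exact hf.hasStrictFDerivAt
  have h1 := hs.eventually_right_inverse
  have h2 := hs.to_localInverse.hasFDerivAt.differentiableAt
  have h3 := hs.localInverse_apply_image
  rw [hq] at h1 h2 h3
  refine (isBigO_pow_of_fixed h2 h3 (mem_vanishingIdeal.1 ha)).congr' ?_ EventuallyEq.rfl
  filter_upwards [h1] with x hx
  simp only [Function.comp, pullback_apply]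
  rw [hx]

theorem aeval_pullback_mem (p : ℂ[X]) {a : analyticAlg q} {k : ℕ} (ha : a ∈ vanishingIdeal q k) :
    aeval (pullback hf hq).toLinearMap p a ∈ vanishingIdeal q k := by
  have hpow : ∀ N : ℕ, ((pullback hf hq).toLinearMap ^ N) a ∈ vanishingIdeal q k := by
    intro N
    induction N with
    | zero => simpa using ha
    | succ N ih =>
      rw [pow_succ', Module.End.mul_apply]
      exact pullback_mem hf hq ih
  rw [aeval_eq_sum_range, LinearMap.sum_apply]
  refine Submodule.sum_mem _ fun i _ => ?_
  rw [LinearMap.smul_apply]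
  exact Submodule.smul_of_tower_mem _ _ (hpow i)

/-! ### Flat functions -/

/-- The ideal of the functions that vanish identically near `q`. -/
def flatIdeal (q : Fin n → ℂ) : Ideal (analyticAlg q) := ⨅ k, vanishingIdeal q k

theorem mem_flatIdeal {a : analyticAlg q} : a ∈ flatIdeal q ↔ ∀ᶠ x in 𝓝 q, a.1 x = 0 := by
  rw [flatIdeal, Ideal.mem_iInf]
  refine ⟨eventually_eq_zero_of_forall_mem, fun h k => ?_⟩
  rw [mem_vanishingIdeal]
  exact (Asymptotics.isBigO_zero _ _).congr' (h.mono fun x hx => hx.symm) EventuallyEq.rfl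

theorem exists_notMem_of_notMem_flatIdeal {a : analyticAlg q} (ha : a ∉ flatIdeal q) :
    ∃ d, a ∉ vanishingIdeal q (d + 1) := by
  rw [flatIdeal, Ideal.mem_iInf] at ha
  push Not at ha
  obtain ⟨d, hd⟩ := ha
  exact ⟨d, fun h => hd (vanishingIdeal_anti q (Nat.le_succ d) h)⟩

theorem mem_flatIdeal_of_mul_mem {a b : analyticAlg q} (ha : a ∉ flatIdeal q)
    (hab : a * b ∈ flatIdeal q) : b ∈ flatIdeal q := by
  obtain ⟨d, hd⟩ := exists_notMem_of_notMem_flatIdeal ha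
  rw [flatIdeal, Ideal.mem_iInf] at hab ⊢
  exact fun k => mem_vanishingIdeal_of_mul_mem hd (hab (k + d))

theorem pullback_mem_flatIdeal {a : analyticAlg q} (ha : a ∈ flatIdeal q) :
    pullback hf hq a ∈ flatIdeal q := by
  rw [flatIdeal, Ideal.mem_iInf] at ha ⊢
  exact fun k => pullback_mem hf hq (ha k)

theorem mem_flatIdeal_of_pullback_mem (hdet : (fderiv ℂ f q).det ≠ 0) {a : analyticAlg q}
    (ha : pullback hf hq a ∈ flatIdeal q) : a ∈ flatIdeal q := by
  rw [flatIdeal, Ideal.mem_iInf] at ha ⊢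
  exact fun k => mem_of_pullback_mem hf hq hdet (ha k)

/-! ### First integrals are annihilated by the derivations -/

/-- If `G / H` is invariant under `f`, it is invariant under all iterates of `f`. -/
theorem integral_pow (hdet : (fderiv ℂ f q).det ≠ 0) {G H : analyticAlg q} (hH : H ∉ flatIdeal q)
    (h : pullback hf hq G * H - G * pullback hf hq H ∈ flatIdeal q) (N : ℕ) :
    ((pullback hf hq).toLinearMap ^ N) G * H - G * ((pullback hf hq).toLinearMap ^ N) H ∈
      flatIdeal q := by
  set T := pullback hf hq
  induction N with
  | zero => simp
  | succ N ih =>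
    have hTH : T H ∉ flatIdeal q := fun h' => hH (mem_flatIdeal_of_pullback_mem hf hq hdet h')
    have h1 : T ((T.toLinearMap ^ N) G) * T H - T G * T ((T.toLinearMap ^ N) H) ∈ flatIdeal q := by
      rw [← map_mul, ← map_mul, ← map_sub]
      exact pullback_mem_flatIdeal hf hq ih
    rw [pow_succ', Module.End.mul_apply, Module.End.mul_apply, AlgHom.toLinearMap_apply,
      AlgHom.toLinearMap_apply]
    refine mem_flatIdeal_of_mul_mem hTH ?_
    have : T H * (T ((T.toLinearMap ^ N) G) * H - G * T ((T.toLinearMap ^ N) H)) =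
        H * (T ((T.toLinearMap ^ N) G) * T H - T G * T ((T.toLinearMap ^ N) H)) +
          T ((T.toLinearMap ^ N) H) * (T G * H - G * T H) := by ring
    rw [this]
    exact add_mem (Ideal.mul_mem_left _ _ h1) (Ideal.mul_mem_left _ _ h)

theorem integral_aeval (hdet : (fderiv ℂ f q).det ≠ 0) {G H : analyticAlg q} (hH : H ∉ flatIdeal q)
    (h : pullback hf hq G * H - G * pullback hf hq H ∈ flatIdeal q) (p : ℂ[X]) :
    aeval (pullback hf hq).toLinearMap p G * H - G * aeval (pullback hf hq).toLinearMap p H ∈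
      flatIdeal q := by
  rw [aeval_eq_sum_range, LinearMap.sum_apply, LinearMap.sum_apply, Finset.sum_mul, Finset.mul_sum,
    ← Finset.sum_sub_distrib]
  refine Submodule.sum_mem _ fun i _ => ?_
  rw [LinearMap.smul_apply, LinearMap.smul_apply, smul_mul_assoc, mul_smul_comm, ← smul_sub]
  exact Submodule.smul_of_tower_mem _ _ (integral_pow hf hq hdet hH h i)

theorem hasFDerivAt_aeval {K : Type*} [Field K] [Algebra K ℂ] (P : MvPolynomial (Fin n) K)
    (x : Fin n → ℂ) :
    HasFDerivAt (fun y : Fin n → ℂ => MvPolynomial.aeval y P)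
      (∑ j, MvPolynomial.aeval x (MvPolynomial.pderiv j P) •
        (ContinuousLinearMap.proj j : (Fin n → ℂ) →L[ℂ] ℂ)) x := by
  induction P using MvPolynomial.induction_on with
  | C c =>
    simp only [MvPolynomial.algHom_C]
    refine (hasFDerivAt_const (𝕜 := ℂ) (algebraMap K ℂ c) x).congr_fderiv ?_
    ext v
    simp
  | add P Q hP hQ =>
    simp only [map_add]
    refine (hP.add hQ).congr_fderiv ?_
    ext v
    simp [add_mul, Finset.sum_add_distrib]
  | mul_X P i hP =>
    have h1 := hP.mul (ContinuousLinearMap.proj (R := ℂ) (φ := fun _ : Fin n => ℂ) i).hasFDerivAt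
    simp only [map_mul, MvPolynomial.aeval_X]
    refine h1.congr_fderiv ?_
    ext v
    simp [MvPolynomial.pderiv_X, Pi.single_apply, apply_ite, mul_add, Finset.sum_add_distrib,
      Finset.mul_sum, mul_comm, mul_left_comm]

theorem partialFn_polyFn (j : Fin n) (P : MvPolynomial (Fin n) ℂ) :
    partialFn q j (polyFn q P) = polyFn q (MvPolynomial.pderiv j P) := by
  apply Subtype.ext
  funext x
  have h1 : HasFDerivAt (polyFn q P).1 (∑ i, MvPolynomial.aeval (x - q) (MvPolynomial.pderiv i P) •
      (ContinuousLinearMap.proj i : (Fin n → ℂ) →L[ℂ] ℂ)) x := by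
    have := (hasFDerivAt_aeval P (x - q)).comp x ((hasFDerivAt_id x).sub_const q)
    refine HasFDerivAt.congr_of_eventuallyEq this (Eventually.of_forall fun y => ?_)
    rw [polyFn_apply, ← MvPolynomial.aeval_eq_eval]
    rfl
  change fderiv ℂ (polyFn q P).1 x (Pi.single j 1) = _
  rw [h1.fderiv, polyFn_apply, ← MvPolynomial.aeval_eq_eval]
  simp [Pi.single_apply]

/-- An operator that preserves orders of vanishing and is a derivation modulo terms of high order
is given by the chain rule. -/
theorem leibniz_eq_sum (D : analyticAlg q →ₗ[ℂ] analyticAlg q) {k : ℕ}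
    (hD : ∀ a ∈ vanishingIdeal q (k + 1), D a ∈ vanishingIdeal q (k + 1))
    (hleib : ∀ a b, D (a * b) - (D a * b + a * D b) ∈ vanishingIdeal q (k + 1))
    (a : analyticAlg q) :
    D a - ∑ j, partialFn q j a * D (coordFn q j) ∈ vanishingIdeal q k := by
  have hpoly : ∀ P, D (polyFn q P) -
      ∑ j, polyFn q (MvPolynomial.pderiv j P) * D (coordFn q j) ∈ vanishingIdeal q (k + 1) := by
    have h1 : D 1 ∈ vanishingIdeal q (k + 1) := by
      have := neg_mem (hleib 1 1)
      rw [mul_one, mul_one, one_mul] at this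
      convert this using 1
      ring
    intro P
    induction P using MvPolynomial.induction_on with
    | C c =>
      have : polyFn q (MvPolynomial.C c) = c • 1 := by
        rw [← MvPolynomial.algebraMap_eq, AlgHom.commutes, Algebra.algebraMap_eq_smul_one]
      rw [this, map_smul]
      simpa using Submodule.smul_of_tower_mem _ c h1
    | add P Q hP hQ =>
      convert add_mem hP hQ using 1
      simp only [map_add, add_mul, Finset.sum_add_distrib]
      ring
    | mul_X P i hP =>
      have hX : polyFn q (MvPolynomial.X i) = coordFn q i := by simp [polyFn]
      have h2 := add_mem (hleib (polyFn q P) (coordFn q i)) (Ideal.mul_mem_right (coordFn q i) _ hP)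
      convert h2 using 1
      simp only [map_mul, hX, Derivation.leibniz, MvPolynomial.pderiv_X, map_add, smul_eq_mul,
        Pi.single_apply]
      simp only [add_mul, Finset.sum_add_distrib]
      have e1 : ∑ x, polyFn q P * polyFn q (if i = x then 1 else 0) * D (coordFn q x) =
          polyFn q P * D (coordFn q i) := by
        rw [Finset.sum_eq_single i]
        · simp
        · intro b _ hb; simp [hb.symm]
        · simp
      have e2 : ∑ x, coordFn q i * polyFn q (MvPolynomial.pderiv x P) * D (coordFn q x) =
          (∑ x, polyFn q (MvPolynomial.pderiv x P) * D (coordFn q x)) * coordFn q i := by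
        rw [Finset.sum_mul]
        exact Finset.sum_congr rfl fun x _ => by ring
      rw [e1, e2]
      ring
  obtain ⟨P, hP⟩ := exists_polyFn_sub_mem a (k + 1)
  have h1 : ∀ j, partialFn q j a - polyFn q (MvPolynomial.pderiv j P) ∈ vanishingIdeal q k := by
    intro j
    have h2 := partialFn_sub q j a (polyFn q P) k
    have h3 := sub_mem (partialFn_mem j hP) h2
    rw [partialFn_polyFn, sub_sub_cancel] at h3
    exact h3
  have h4 : D a - ∑ j, partialFn q j a * D (coordFn q j) =
      D (a - polyFn q P) + (D (polyFn q P) -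
        ∑ j, polyFn q (MvPolynomial.pderiv j P) * D (coordFn q j)) -
      ∑ j, (partialFn q j a - polyFn q (MvPolynomial.pderiv j P)) * D (coordFn q j) := by
    simp only [sub_mul, Finset.sum_sub_distrib, map_sub]
    ring
  rw [h4]
  exact sub_mem (add_mem (vanishingIdeal_anti q k.le_succ (hD _ hP))
    (vanishingIdeal_anti q k.le_succ (hpoly P)))
    (Submodule.sum_mem _ fun j _ => Ideal.mul_mem_right _ _ (h1 j))

/-- The matrix of the differentials of `G i / H i`, with the `i`-th row multiplied by `(H i)²`. -/
noncomputable def integralMatrix (G H : Fin n → analyticAlg q) :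
    Matrix (Fin n) (Fin n) (analyticAlg q) :=
  fun i j => partialFn q j (G i) * H i - G i * partialFn q j (H i)

theorem integralMatrix_apply_of_ne_zero (G H : Fin n → analyticAlg q) (i j : Fin n)
    {x : Fin n → ℂ} (hG : DifferentiableAt ℂ (G i).1 x) (hH : DifferentiableAt ℂ (H i).1 x)
    (h0 : (H i).1 x ≠ 0) :
    (integralMatrix G H i j).1 x =
      (H i).1 x ^ 2 * fderiv ℂ (fun y => (G i).1 y / (H i).1 y) x (Pi.single j 1) := by
  have hquot : DifferentiableAt ℂ (fun y => (G i).1 y / (H i).1 y) x := by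
    simp only [div_eq_mul_inv]
    exact hG.mul (hH.inv h0)
  have h1 : (G i).1 =ᶠ[𝓝 x] fun y => ((G i).1 y / (H i).1 y) * (H i).1 y := by
    filter_upwards [hH.continuousAt.eventually_ne h0] with y hy
    rw [div_mul_cancel₀ _ hy]
  have h2 : fderiv ℂ (G i).1 x = ((G i).1 x / (H i).1 x) • fderiv ℂ (H i).1 x +
      (H i).1 x • fderiv ℂ (fun y => (G i).1 y / (H i).1 y) x := by
    rw [h1.fderiv_eq, fderiv_fun_mul hquot hH]
  change fderiv ℂ (G i).1 x _ * (H i).1 x - (G i).1 x * fderiv ℂ (H i).1 x _ = _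
  rw [h2]
  simp only [add_apply, smul_apply, smul_eq_mul]
  field_simp
  ring

theorem det_integralMatrix_notMem_flatIdeal (G H : Fin n → analyticAlg q)
    (hind : FunctionallyIndependentAt q (fun i => (G i).1) (fun i => (H i).1)) :
    (integralMatrix G H).det ∉ flatIdeal q := by
  rw [mem_flatIdeal]
  intro h0
  obtain ⟨V, hV, hVc⟩ := hind
  have hfr := mem_closure_iff_frequently.1 (hVc (mem_of_mem_nhds hV))
  have hG : ∀ᶠ x in 𝓝 q, ∀ i, AnalyticAt ℂ (G i).1 x :=
    eventually_all.2 fun i => (G i).2.eventually_analyticAt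
  have hH : ∀ᶠ x in 𝓝 q, ∀ i, AnalyticAt ℂ (H i).1 x :=
    eventually_all.2 fun i => (H i).2.eventually_analyticAt
  obtain ⟨x, ⟨-, hHx, hli⟩, hx0, hGa, hHa⟩ := (hfr.and_eventually (h0.and (hG.and hH))).exists
  have hdet : Matrix.det (fun i j => (integralMatrix G H i j).1 x) = 0 := by
    rw [← hx0]
    exact ((Pi.evalRingHom (fun _ : Fin n → ℂ => ℂ) x).comp
      (analyticAlg q).val.toRingHom).map_det (integralMatrix G H) |>.symm
  obtain ⟨v, hv0, hv⟩ := Matrix.exists_vecMul_eq_zero_iff.2 hdet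
  apply hv0
  have hsum : ∑ i, (v i * (H i).1 x ^ 2) • fderiv ℂ (fun y => (G i).1 y / (H i).1 y) x = 0 := by
    apply ContinuousLinearMap.coe_injective
    apply (Pi.basisFun ℂ (Fin n)).ext
    intro j
    have := congrFun hv j
    simp only [Matrix.vecMul, dotProduct, Pi.zero_apply] at this
    simp only [Pi.basisFun_apply, ContinuousLinearMap.coe_coe, ContinuousLinearMap.toLinearMap_zero,
      LinearMap.zero_apply, sum_apply, smul_apply, smul_eq_mul]
    rw [← this]
    refine Finset.sum_congr rfl fun i _ => ?_
    rw [integralMatrix_apply_of_ne_zero G H i j (hGa i).differentiableAt (hHa i).differentiableAt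
      (hHx i), mul_assoc]
  funext i
  have := Fintype.linearIndependent_iff.1 hli _ hsum i
  exact (mul_eq_zero.1 this).resolve_right (pow_ne_zero 2 (hHx i))

/-- If `f` has `n` functionally independent first integrals, every polynomial in the pullback by
`f` that is a derivation up to high order vanishes up to high order: it annihilates the
integrals, so its values on the coordinates solve a linear system with nonzero determinant. -/
theorem exists_order_bound (hdet : (fderiv ℂ f q).det ≠ 0) {G H : Fin n → (Fin n → ℂ) → ℂ}
    (hint : ∀ i, IsMeromorphicFirstIntegral f q (G i) (H i))
    (hind : FunctionallyIndependentAt q G H) :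
    ∃ d, ∀ (k : ℕ) (p : ℂ[X]),
      (∀ a b, aeval (pullback hf hq).toLinearMap p (a * b) -
        (aeval (pullback hf hq).toLinearMap p a * b + a * aeval (pullback hf hq).toLinearMap p b) ∈
          vanishingIdeal q (k + d + 1)) →
      ∀ a, aeval (pullback hf hq).toLinearMap p a ∈ vanishingIdeal q k := by
  set G' : Fin n → analyticAlg q := fun i => ⟨G i, (hint i).1⟩ with hG'
  set H' : Fin n → analyticAlg q := fun i => ⟨H i, (hint i).2.1⟩ with hH'
  obtain ⟨d, hd⟩ := exists_notMem_of_notMem_flatIdeal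
    (det_integralMatrix_notMem_flatIdeal G' H' hind)
  refine ⟨d, fun k p hleib => ?_⟩
  set D := aeval (pullback hf hq).toLinearMap p
  have hsum := leibniz_eq_sum D (fun a ha => aeval_pullback_mem hf hq p ha) hleib
  set Y : Fin n → analyticAlg q := fun j => D (coordFn q j) with hY
  have hMY : ∀ i, ((integralMatrix G' H').mulVec Y) i ∈ vanishingIdeal q (k + d) := by
    intro i
    have hflat : D (G' i) * H' i - G' i * D (H' i) ∈ flatIdeal q := by
      apply integral_aeval hf hq hdet
      · rw [mem_flatIdeal]; exact (hint i).2.2.1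
      · rw [mem_flatIdeal]
        filter_upwards [(hint i).2.2.2] with x hx
        exact sub_eq_zero.2 hx
    have h1 : D (G' i) * H' i - G' i * D (H' i) ∈ vanishingIdeal q (k + d) := by
      rw [flatIdeal, Ideal.mem_iInf] at hflat
      exact hflat _
    have h2 := sub_mem (Ideal.mul_mem_right (H' i) _ (hsum (G' i)))
      (Ideal.mul_mem_left _ (G' i) (hsum (H' i)))
    convert sub_mem h1 h2 using 1
    simp only [Matrix.mulVec, dotProduct, integralMatrix, sub_mul, Finset.sum_sub_distrib, mul_sub,
      Finset.sum_mul, Finset.mul_sum]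
    have e1 : ∀ j, partialFn q j (G' i) * H' i * Y j = partialFn q j (G' i) * Y j * H' i :=
      fun j => by ring
    have e2 : ∀ j, G' i * partialFn q j (H' i) * Y j = G' i * (partialFn q j (H' i) * Y j) :=
      fun j => by ring
    rw [Finset.sum_congr rfl fun j _ => e1 j, Finset.sum_congr rfl fun j _ => e2 j]
    ring
  have hYk : ∀ j, Y j ∈ vanishingIdeal q k := by
    intro j
    refine mem_vanishingIdeal_of_mul_mem hd ?_
    have h1 : (integralMatrix G' H').det * Y j =
        ((integralMatrix G' H').adjugate.mulVec ((integralMatrix G' H').mulVec Y)) j := by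
      rw [Matrix.mulVec_mulVec, Matrix.adjugate_mul, Matrix.smul_mulVec, Matrix.one_mulVec]
      rfl
    rw [h1]
    exact Submodule.sum_mem _ fun i _ => Ideal.mul_mem_left _ _ (hMY i)
  intro a
  have := add_mem (vanishingIdeal_anti q (Nat.le_add_right k d) (hsum a))
    (Submodule.sum_mem _ fun j _ => Ideal.mul_mem_left _ (partialFn q j a) (hYk j) :
      ∑ j, partialFn q j a * D (coordFn q j) ∈ vanishingIdeal q k)
  simpa using this

end Pullback

end MeroInt
namespace MeroInt

/-! ### The action on jets -/

section JetAction

open Polynomial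

variable {n : ℕ} {q : Fin n → ℂ} {f : (Fin n → ℂ) → (Fin n → ℂ)}

/-- The algebra of `(k - 1)`-jets at `q` of analytic functions. -/
def Jet (q : Fin n → ℂ) (k : ℕ) : Type := analyticAlg q ⧸ vanishingIdeal q k

noncomputable instance (q : Fin n → ℂ) (k : ℕ) : CommRing (Jet q k) :=
  inferInstanceAs (CommRing (analyticAlg q ⧸ vanishingIdeal q k))

noncomputable instance (q : Fin n → ℂ) (k : ℕ) : Algebra ℂ (Jet q k) :=
  inferInstanceAs (Algebra ℂ (analyticAlg q ⧸ vanishingIdeal q k))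

/-- The jet of an analytic function. -/
noncomputable def toJet (q : Fin n → ℂ) (k : ℕ) : analyticAlg q →ₐ[ℂ] Jet q k :=
  Ideal.Quotient.mkₐ ℂ (vanishingIdeal q k)

theorem toJet_surjective (q : Fin n → ℂ) (k : ℕ) : Function.Surjective (toJet q k) :=
  Ideal.Quotient.mkₐ_surjective ℂ _

theorem toJet_eq_zero_iff {k : ℕ} {a : analyticAlg q} :
    toJet q k a = 0 ↔ a ∈ vanishingIdeal q k :=
  Ideal.Quotient.eq_zero_iff_mem

theorem toJet_eq_iff {k : ℕ} {a b : analyticAlg q} :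
    toJet q k a = toJet q k b ↔ a - b ∈ vanishingIdeal q k :=
  Ideal.Quotient.eq

theorem finiteDimensional_jet (q : Fin n → ℂ) (k : ℕ) : FiniteDimensional ℂ (Jet q k) := by
  classical
  set e : (Fin n → Fin k) → Jet q k := fun d =>
    toJet q k (polyFn q (MvPolynomial.monomial
      (Finsupp.equivFunOnFinite.symm fun i => (d i : ℕ)) 1)) with he
  have hspan : Submodule.span ℂ (Set.range e) = ⊤ := by
    rw [eq_top_iff]
    rintro v -
    obtain ⟨a, rfl⟩ := toJet_surjective q k v
    obtain ⟨P, hP⟩ := exists_polyFn_sub_mem a k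
    rw [toJet_eq_iff.2 hP, P.as_sum, map_sum, map_sum]
    refine Submodule.sum_mem _ fun d _ => ?_
    have hmon : toJet q k (polyFn q (MvPolynomial.monomial d (P.coeff d))) =
        P.coeff d • toJet q k (polyFn q (MvPolynomial.monomial d 1)) := by
      rw [← map_smul, ← map_smul, MvPolynomial.smul_monomial, smul_eq_mul, mul_one]
    rw [hmon]
    refine Submodule.smul_mem _ _ ?_
    by_cases hd : Finsupp.degree d < k
    · have hdi : ∀ i, d i < k := fun i => lt_of_le_of_lt (Finsupp.le_degree i d) hd
      refine Submodule.subset_span ⟨fun i => ⟨d i, hdi i⟩, ?_⟩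
      rw [he]
      have : (Finsupp.equivFunOnFinite.symm fun i => d i) = d := Finsupp.ext fun i => rfl
      simp only [this]
    · have : polyFn q (MvPolynomial.monomial d 1) ∈ vanishingIdeal q k := by
        apply polyFn_mem_of_mem_pow
        rw [MvPolynomial.monomial_mem_pow_idealOfVars_iff _ _ one_ne_zero]
        omega
      rw [toJet_eq_zero_iff.2 this]
      exact Submodule.zero_mem _
  exact Module.finite_def.2 (hspan ▸ Submodule.fg_span (Set.finite_range e))

/-- The action of `f` on jets. -/
noncomputable def jetMap (hf : AnalyticAt ℂ f q) (hq : f q = q) (k : ℕ) : Jet q k →ₐ[ℂ] Jet q k :=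
  Ideal.quotientMapₐ _ (pullback hf hq) fun _ ha => pullback_mem hf hq ha

variable (hf : AnalyticAt ℂ f q) (hq : f q = q)

theorem jetMap_toJet (k : ℕ) (a : analyticAlg q) :
    jetMap hf hq k (toJet q k a) = toJet q k (pullback hf hq a) := rfl

theorem jetMap_injective (hdet : (fderiv ℂ f q).det ≠ 0) (k : ℕ) :
    Function.Injective (jetMap hf hq k) := by
  rw [injective_iff_map_eq_zero]
  intro v hv
  obtain ⟨a, rfl⟩ := toJet_surjective q k v
  rw [jetMap_toJet, toJet_eq_zero_iff] at hv
  rw [toJet_eq_zero_iff]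
  exact mem_of_pullback_mem hf hq hdet hv

theorem aeval_jetMap_toJet (k : ℕ) (p : ℂ[X]) (a : analyticAlg q) :
    aeval (jetMap hf hq k).toLinearMap p (toJet q k a) =
      toJet q k (aeval (pullback hf hq).toLinearMap p a) := by
  have hpow : ∀ N : ℕ, ((jetMap hf hq k).toLinearMap ^ N) (toJet q k a) =
      toJet q k (((pullback hf hq).toLinearMap ^ N) a) := by
    intro N
    induction N with
    | zero => rfl
    | succ N ih =>
      rw [pow_succ', Module.End.mul_apply, ih, pow_succ', Module.End.mul_apply]
      rfl
  rw [aeval_eq_sum_range, aeval_eq_sum_range, LinearMap.sum_apply, LinearMap.sum_apply, map_sum]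
  refine Finset.sum_congr rfl fun i _ => ?_
  rw [LinearMap.smul_apply, LinearMap.smul_apply, hpow, map_smul]

theorem leibniz_of_jetMap {k : ℕ} {p : ℂ[X]}
    (h : ∀ a b, aeval (jetMap hf hq k).toLinearMap p (a * b) =
      aeval (jetMap hf hq k).toLinearMap p a * b + a * aeval (jetMap hf hq k).toLinearMap p b)
    (a b : analyticAlg q) :
    aeval (pullback hf hq).toLinearMap p (a * b) -
      (aeval (pullback hf hq).toLinearMap p a * b + a * aeval (pullback hf hq).toLinearMap p b) ∈
        vanishingIdeal q k := by
  have := h (toJet q k a) (toJet q k b)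
  rw [← map_mul, aeval_jetMap_toJet, aeval_jetMap_toJet, aeval_jetMap_toJet, ← map_mul, ← map_mul,
    ← map_add] at this
  exact toJet_eq_iff.1 this

/-- The linear form `w`, centred at `q`. -/
noncomputable def linFn (q : Fin n → ℂ) (w : (Fin n → ℂ) →L[ℂ] ℂ) : analyticAlg q :=
  ⟨fun x => w (x - q), by
    have h : AnalyticAt ℂ (fun x : Fin n → ℂ => x - q) q := analyticAt_id.sub analyticAt_const
    exact (w.analyticAt _).comp h⟩

theorem hasFDerivAt_linFn (w : (Fin n → ℂ) →L[ℂ] ℂ) (x : Fin n → ℂ) :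
    HasFDerivAt (linFn q w).1 w x :=
  w.hasFDerivAt.comp x ((hasFDerivAt_id x).sub_const q)

theorem mem_vanishingIdeal_one {a : analyticAlg q} (h0 : a.1 q = 0) : a ∈ vanishingIdeal q 1 := by
  rw [mem_vanishingIdeal]
  have := a.2.differentiableAt.isBigO_sub
  simp only [h0, sub_zero] at this
  simpa using this.norm_right

theorem apply_eq_zero_of_mem {a : analyticAlg q} (h : a ∈ vanishingIdeal q 1) : a.1 q = 0 := by
  obtain ⟨C, hC⟩ := (mem_vanishingIdeal.1 h).bound
  simpa using hC.self_of_nhds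

theorem mem_vanishingIdeal_two {a : analyticAlg q} (h0 : a.1 q = 0) (h1 : fderiv ℂ a.1 q = 0) :
    a ∈ vanishingIdeal q 2 := by
  obtain ⟨p, hp⟩ := a.2
  rw [mem_vanishingIdeal]
  have h2 : Tendsto (fun x => x - q) (𝓝 q) (𝓝 0) := by
    have : Continuous fun x => x - q := by fun_prop
    simpa using this.tendsto q
  refine ((hp.isBigO_sub_partialSum_pow 2).comp_tendsto h2).congr_left fun x => ?_
  have e0 : (p 0 fun _ => x - q) = 0 := by
    rw [hp.coeff_zero]; exact h0
  have e1 : (p 1 fun _ => x - q) = 0 := by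
    have h3 := hp.hasFDerivAt.fderiv
    rw [h1] at h3
    have h4 := congrArg (fun L : (Fin n → ℂ) →L[ℂ] ℂ => L (x - q)) h3
    simp only [zero_apply, continuousMultilinearCurryFin1_apply] at h4
    rw [h4]
    congr 1
  simp only [Function.comp, add_sub_cancel, FormalMultilinearSeries.partialSum,
    Finset.sum_range_succ, Finset.sum_range_zero, e0, e1, add_zero, sub_zero]

theorem linFn_eq_zero_of_mem {w : (Fin n → ℂ) →L[ℂ] ℂ} (h : linFn q w ∈ vanishingIdeal q 2) :
    w = 0 := by
  set P : MvPolynomial (Fin n) ℂ :=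
    ∑ j, MvPolynomial.C (w (Pi.single j 1)) * MvPolynomial.X j with hP
  have hev : ∀ v, MvPolynomial.eval v P = w v := by
    intro v
    conv_rhs => rw [pi_eq_sum_univ' v]
    simp [hP, mul_comm]
  have hPw : polyFn q P = linFn q w := by
    apply Subtype.ext
    funext x
    rw [polyFn_apply, hev]
    rfl
  have hhom : P.IsHomogeneous 1 := by
    refine MvPolynomial.IsHomogeneous.sum _ _ _ fun j _ => ?_
    simpa using (MvPolynomial.isHomogeneous_C (Fin n) (w (Pi.single j 1))).mul
      (MvPolynomial.isHomogeneous_X ℂ j)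
  have h0 := homogeneous_eq_zero_of_polyFn_mem hhom (hPw ▸ h)
  ext v
  rw [← hev, h0, map_zero, zero_apply]

theorem pullback_linFn_sub_mem (w : (Fin n → ℂ) →L[ℂ] ℂ) :
    pullback hf hq (linFn q w) - linFn q (w.comp (fderiv ℂ f q)) ∈ vanishingIdeal q 2 := by
  have h1 : HasFDerivAt (pullback hf hq (linFn q w)).1 (w.comp (fderiv ℂ f q)) q :=
    (hasFDerivAt_linFn w (f q)).comp q hf.differentiableAt.hasFDerivAt
  apply mem_vanishingIdeal_two
  · change w (f q - q) - w.comp (fderiv ℂ f q) (q - q) = 0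
    rw [hq]; simp
  · have := (h1.sub (hasFDerivAt_linFn (q := q) (w.comp (fderiv ℂ f q)) q)).fderiv
    rw [sub_self] at this
    exact this

/-! ### The eigenvalues are roots of unity -/

/-- `ℂ` is divisible, so a nonzero additive character of the infinite cyclic group generated by
`μ` extends to all nonzero complex numbers. -/
theorem exists_character {μ : ℂ} (h0 : μ ≠ 0) (h : ∀ p : ℕ, 0 < p → μ ^ p ≠ 1) :
    ∃ χ : ℂ → ℂ, (∀ l m, l ≠ 0 → m ≠ 0 → χ (l * m) = χ l + χ m) ∧ χ μ ≠ 0 := by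
  classical
  set u : ℂˣ := Units.mk0 μ h0
  have hinj : Function.Injective (zmultiplesHom (Additive ℂˣ) (Additive.ofMul u)) := by
    rw [injective_iff_map_eq_zero]
    intro z hz
    have hu : u ^ z = 1 := hz
    by_contra hne
    have hz' : 0 < z.natAbs := Int.natAbs_pos.2 hne
    have : u ^ z.natAbs = 1 := by
      rcases Int.natAbs_eq z with hz2 | hz2
      · rw [hz2, zpow_natCast] at hu; exact hu
      · rw [hz2, zpow_neg, zpow_natCast, inv_eq_one] at hu; exact hu
    apply h _ hz'
    simpa [u] using congrArg Units.val this
  obtain ⟨φ, hφ⟩ := (Module.Baer.of_divisible ℂ).extension_property_addMonoidHom _ hinj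
    (Int.castAddHom ℂ)
  refine ⟨fun l => if hl : l = 0 then 0 else φ (Additive.ofMul (Units.mk0 l hl)),
    fun l m hl hm => ?_, ?_⟩
  · simp only [dif_neg hl, dif_neg hm, dif_neg (mul_ne_zero hl hm)]
    rw [← map_add, ← ofMul_mul, Units.mk0_mul]
  · simp only [dif_neg h0]
    have := DFunLike.congr_fun hφ 1
    simp only [AddMonoidHom.comp_apply, zmultiplesHom_apply, one_smul, Int.coe_castAddHom,
      Int.cast_one] at this
    rw [this]
    exact one_ne_zero

theorem exists_left_eigenvector {μ : ℂ} (hμ : IsEigenvalueAt f q μ) :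
    ∃ w : (Fin n → ℂ) →L[ℂ] ℂ, w ≠ 0 ∧ w.comp (fderiv ℂ f q) = μ • w := by
  set A : Module.End ℂ (Fin n → ℂ) := (fderiv ℂ f q : (Fin n → ℂ) →ₗ[ℂ] (Fin n → ℂ))
  have hr : LinearMap.range (A - μ • (1 : Module.End ℂ (Fin n → ℂ))) < ⊤ := by
    rw [lt_top_iff_ne_top]
    intro htop
    have hinj : Function.Injective (A - μ • (1 : Module.End ℂ (Fin n → ℂ))) :=
      LinearMap.injective_iff_surjective.2 (LinearMap.range_eq_top.1 htop)
    obtain ⟨v, hv⟩ := hμ.exists_hasEigenvector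
    apply hv.2
    apply hinj
    have := hv.apply_eq_smul
    rw [map_zero, LinearMap.sub_apply, LinearMap.smul_apply, Module.End.one_apply]
    exact sub_eq_zero.2 this
  obtain ⟨w, hw0, hw⟩ := Submodule.exists_le_ker_of_lt_top _ hr
  refine ⟨LinearMap.toContinuousLinearMap w, ?_, ?_⟩
  · intro h
    apply hw0
    simpa using h
  · ext v
    have := hw ⟨v, rfl⟩
    rw [LinearMap.mem_ker, LinearMap.sub_apply, LinearMap.smul_apply, Module.End.one_apply,
      map_sub, map_smul, sub_eq_zero] at this
    exact this

theorem jetMap_hasEigenvector {μ : ℂ} {w : (Fin n → ℂ) →L[ℂ] ℂ} (hw0 : w ≠ 0)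
    (hw : w.comp (fderiv ℂ f q) = μ • w) :
    Module.End.HasEigenvector (jetMap hf hq 2).toLinearMap μ
      (toJet q 2 (linFn q w)) := by
  rw [Module.End.hasEigenvector_iff, Module.End.mem_eigenspace_iff]
  constructor
  · have h1 := pullback_linFn_sub_mem hf hq w
    rw [hw] at h1
    rw [AlgHom.toLinearMap_apply, jetMap_toJet, toJet_eq_iff.2 h1, ← map_smul]
    rfl
  · intro h
    exact hw0 (linFn_eq_zero_of_mem (toJet_eq_zero_iff.1 h))

/-- A polynomial in the pullback that kills the linear part of an eigenform vanishes at the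
eigenvalue. -/
theorem eval_eq_zero_of_aeval_linFn_mem {μ : ℂ} {w : (Fin n → ℂ) →L[ℂ] ℂ} (hw0 : w ≠ 0)
    (hw : w.comp (fderiv ℂ f q) = μ • w) (r : ℂ[X])
    (hr : aeval (pullback hf hq).toLinearMap r (linFn q w) ∈ vanishingIdeal q 2) :
    r.eval μ = 0 := by
  have hvec := jetMap_hasEigenvector hf hq hw0 hw
  have h1 := Module.End.aeval_apply_of_hasEigenvector (p := r) hvec
  rw [aeval_jetMap_toJet, toJet_eq_zero_iff.2 hr] at h1
  exact (smul_eq_zero.1 h1.symm).resolve_right hvec.2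

/-- If `μ` were not a root of unity, an additive character with `χ μ ≠ 0` would give a derivation
of the jets with the nonzero eigenvalue `χ μ` on an eigenform; but such a derivation vanishes up to
high order. -/
theorem exists_pow_eq_one_of_eigenvalue (hf : AnalyticAt ℂ f q) (hq : f q = q)
    (hdet : (fderiv ℂ f q).det ≠ 0)
    {G H : Fin n → (Fin n → ℂ) → ℂ} (hint : ∀ i, IsMeromorphicFirstIntegral f q (G i) (H i))
    (hind : FunctionallyIndependentAt q G H) {μ : ℂ} (hμ : IsEigenvalueAt f q μ) :
    ∃ p : ℕ, 0 < p ∧ μ ^ p = 1 := by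
  by_contra! hno
  obtain ⟨w, hw0, hw⟩ := exists_left_eigenvector hμ
  have hμ0 : μ ≠ 0 := by
    rintro rfl
    obtain ⟨v, hv⟩ := hμ.exists_hasEigenvector
    apply hv.2
    have h1 := hv.apply_eq_smul
    rw [zero_smul] at h1
    have h2 : Function.Injective (fderiv ℂ f q) := by
      have := ((fderiv ℂ f q).toContinuousLinearEquivOfDetNeZero hdet).injective
      exact this
    exact h2 (by rw [map_zero]; exact h1)
  obtain ⟨χ, hχ, hχμ⟩ := exists_character hμ0 hno
  obtain ⟨d, hd⟩ := exists_order_bound hf hq hdet hint hind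
  have := finiteDimensional_jet q (2 + d + 1)
  obtain ⟨p, hpχ, hleib⟩ := exists_leibniz_of_character (jetMap hf hq (2 + d + 1))
    (jetMap_injective hf hq hdet _) χ hχ
  have hp2 := hd 2 p (leibniz_of_jetMap hf hq hleib)
  have hev : Module.End.HasEigenvalue (jetMap hf hq (2 + d + 1)).toLinearMap μ := by
    rw [Module.End.hasEigenvalue_iff_isRoot]
    apply eval_eq_zero_of_aeval_linFn_mem hf hq hw0 hw
    apply vanishingIdeal_anti q (show 2 ≤ 2 + d + 1 by omega)
    rw [← toJet_eq_zero_iff, ← aeval_jetMap_toJet, minpoly.aeval, LinearMap.zero_apply]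
  apply hχμ
  rw [← hpχ μ hev]
  exact eval_eq_zero_of_aeval_linFn_mem hf hq hw0 hw p (hp2 _)

theorem exists_pow_eq_one (hf : AnalyticAt ℂ f q) (hq : f q = q)
    (hdet : (fderiv ℂ f q).det ≠ 0)
    {G H : Fin n → (Fin n → ℂ) → ℂ} (hint : ∀ i, IsMeromorphicFirstIntegral f q (G i) (H i))
    (hind : FunctionallyIndependentAt q G H) :
    ∃ p : ℕ, 0 < p ∧ ∀ μ, IsEigenvalueAt f q μ → μ ^ p = 1 := by
  classical
  have h := fun μ (hμ : IsEigenvalueAt f q μ) =>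
    exists_pow_eq_one_of_eigenvalue hf hq hdet hint hind hμ
  have hfin : {μ | IsEigenvalueAt f q μ}.Finite := by
    refine (minpoly ℂ (fderiv ℂ f q :
      (Fin n → ℂ) →ₗ[ℂ] (Fin n → ℂ))).roots.toFinset.finite_toSet.subset fun μ hμ => ?_
    rw [Finset.mem_coe, Multiset.mem_toFinset,
      mem_roots (minpoly.ne_zero (Algebra.IsIntegral.isIntegral _))]
    exact Module.End.hasEigenvalue_iff_isRoot.1 hμ
  choose! N hN using h
  refine ⟨∏ μ ∈ hfin.toFinset, N μ, Finset.prod_pos fun μ hμ => (hN μ (by simpa using hμ)).1,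
    fun μ hμ => ?_⟩
  rw [← Finset.mul_prod_erase _ _ (hfin.mem_toFinset.2 hμ), pow_mul, (hN μ hμ).2, one_pow]

end JetAction

end MeroInt
namespace MeroInt

/-! ### Unipotent maps -/

section Unipotent

open Polynomial

variable {n : ℕ} {q : Fin n → ℂ} {f : (Fin n → ℂ) → (Fin n → ℂ)}

variable (hf : AnalyticAt ℂ f q) (hq : f q = q)

/-- The operator `a ↦ a ∘ f - a`. -/
def pullbackSubOne : Module.End ℂ (analyticAlg q) := (pullback hf hq).toLinearMap - 1

theorem pullbackSubOne_apply (a : analyticAlg q) :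
    pullbackSubOne hf hq a = pullback hf hq a - a := rfl

theorem pullback_sub_one_pow_mem {a : analyticAlg q} {k : ℕ} (ha : a ∈ vanishingIdeal q k) (r : ℕ) :
    (pullbackSubOne hf hq ^ r) a ∈ vanishingIdeal q k := by
  induction r with
  | zero => simpa using ha
  | succ r ih =>
    rw [pow_succ', Module.End.mul_apply, pullbackSubOne_apply]
    exact sub_mem (pullback_mem hf hq ih) ih

/-- By the twisted Leibniz rule `L (a b) = L a * f^* b + a * L b` for `L = f^* - 1`, nilpotency on
the homogeneous parts of degrees `i` and `j` gives nilpotency on their product. -/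
theorem pullback_sub_one_pow_mul_mem {i j : ℕ} (r s : ℕ) {a b : analyticAlg q}
    (ha : a ∈ vanishingIdeal q i) (hb : b ∈ vanishingIdeal q j)
    (har : (pullbackSubOne hf hq ^ r) a ∈ vanishingIdeal q (i + 1))
    (hbs : (pullbackSubOne hf hq ^ s) b ∈ vanishingIdeal q (j + 1)) :
    (pullbackSubOne hf hq ^ (r + s)) (a * b) ∈ vanishingIdeal q (i + j + 1) := by
  set T := pullback hf hq with hT
  set L := pullbackSubOne hf hq with hL
  induction h : r + s generalizing r s a b with
  | zero =>
    obtain rfl : r = 0 := by omega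
    have h1 : a ∈ vanishingIdeal q (i + 1) := by simpa using har
    have := mul_mem_vanishingIdeal h1 hb
    rw [pow_zero, Module.End.one_apply]
    exact vanishingIdeal_anti q (by omega) this
  | succ k ih =>
    rcases r with _ | r
    · have h1 : a ∈ vanishingIdeal q (i + 1) := by simpa using har
      exact pullback_sub_one_pow_mem hf hq
        (vanishingIdeal_anti q (by omega) (mul_mem_vanishingIdeal h1 hb)) _
    rcases s with _ | s
    · have h1 : b ∈ vanishingIdeal q (j + 1) := by simpa using hbs
      exact pullback_sub_one_pow_mem hf hq
        (vanishingIdeal_anti q (by omega) (mul_mem_vanishingIdeal ha h1)) _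
    have hstep : L (a * b) =
        L a * T b + a * L b := by
      simp only [hL, pullbackSubOne_apply, ← hT, map_mul]
      ring
    have hTb : (L ^ (s + 1)) (T b) ∈ vanishingIdeal q (j + 1) := by
      have hc1 : Commute L T.toLinearMap := by
        have h : L + 1 = T.toLinearMap := LinearMap.ext fun a => sub_add_cancel (T a) a
        rw [← h]
        exact (Commute.refl L).add_right (Commute.one_right L)
      have := LinearMap.congr_fun (hc1.pow_left (s + 1)).eq b
      simp only [Module.End.mul_apply, AlgHom.toLinearMap_apply] at this
      rw [this]
      exact pullback_mem hf hq hbs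
    have ha1 : L a ∈ vanishingIdeal q i := by
      simpa using pullback_sub_one_pow_mem hf hq ha 1
    have hb1 : L b ∈ vanishingIdeal q j := by
      simpa using pullback_sub_one_pow_mem hf hq hb 1
    have har' := har
    rw [pow_succ, Module.End.mul_apply] at har' hbs ⊢
    rw [hstep, map_add]
    exact add_mem (ih r (s + 1) ha1 (pullback_mem hf hq hb) har' hTb (by omega))
      (ih (r + 1) s ha hb1 har hbs (by omega))

theorem pullback_sub_one_pow_linFn_mem (w : (Fin n → ℂ) →L[ℂ] ℂ) (r : ℕ) :
    (pullbackSubOne hf hq ^ r) (linFn q w) -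
      linFn q (w.comp ((fderiv ℂ f q - 1) ^ r)) ∈ vanishingIdeal q 2 := by
  induction r with
  | zero =>
    have : w.comp ((fderiv ℂ f q - 1) ^ 0) = w := by ext v; simp
    rw [this]; simp
  | succ r ih =>
    set u := w.comp ((fderiv ℂ f q - 1) ^ r) with hu
    have h1 := pullback_sub_one_pow_mem hf hq ih 1
    rw [pow_one, map_sub, ← Module.End.mul_apply, ← pow_succ'] at h1
    have h2 := pullback_linFn_sub_mem hf hq u
    have h3 : linFn q (w.comp ((fderiv ℂ f q - 1) ^ (r + 1))) =
        linFn q (u.comp (fderiv ℂ f q)) - linFn q u := by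
      apply Subtype.ext
      funext x
      change w (((fderiv ℂ f q - 1) ^ (r + 1)) (x - q)) = u (fderiv ℂ f q (x - q)) - u (x - q)
      rw [hu, pow_succ]
      change w (((fderiv ℂ f q - 1) ^ r) (fderiv ℂ f q (x - q) - (x - q))) = _
      rw [map_sub, map_sub]
      rfl
    rw [h3]
    convert add_mem h1 h2 using 1
    rw [pullbackSubOne_apply]
    ring

/-- If the differential of `f` is unipotent, `f` acts unipotently on the homogeneous parts of all
degrees, hence on jets. -/
theorem exists_pullback_sub_one_pow_mem (hf : AnalyticAt ℂ f q) (hq : f q = q) {r : ℕ}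
    (hr : (fderiv ℂ f q - 1) ^ r = 0) (k : ℕ) :
    ∃ m, ∀ a, (pullbackSubOne hf hq ^ m) a ∈ vanishingIdeal q k := by
  have h0 : ∀ a ∈ vanishingIdeal q 0,
      (pullbackSubOne hf hq ^ 1) a ∈ vanishingIdeal q 1 := by
    intro a _
    apply mem_vanishingIdeal_one
    rw [pow_one]
    change a.1 (f q) - a.1 q = 0
    rw [hq, sub_self]
  have h1 : ∀ a ∈ vanishingIdeal q 1,
      (pullbackSubOne hf hq ^ r) a ∈ vanishingIdeal q 2 := by
    intro a ha
    have h2 : a - linFn q (fderiv ℂ a.1 q) ∈ vanishingIdeal q 2 := by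
      apply mem_vanishingIdeal_two
      · change a.1 q - fderiv ℂ a.1 q (q - q) = 0
        rw [apply_eq_zero_of_mem ha]; simp
      · have := (a.2.differentiableAt.hasFDerivAt.sub
          (hasFDerivAt_linFn (q := q) (fderiv ℂ a.1 q) q)).fderiv
        rw [sub_self] at this
        exact this
    have h3 := pullback_sub_one_pow_linFn_mem hf hq (fderiv ℂ a.1 q) r
    rw [hr] at h3
    have h4 : linFn q ((fderiv ℂ a.1 q).comp (0 : (Fin n → ℂ) →L[ℂ] (Fin n → ℂ))) = 0 := by
      apply Subtype.ext
      funext x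
      change fderiv ℂ a.1 q 0 = 0
      rw [map_zero]
    rw [h4, sub_zero] at h3
    have h5 := add_mem (pullback_sub_one_pow_mem hf hq h2 r) h3
    rw [← map_add, sub_add_cancel] at h5
    exact h5
  have hstep : ∀ i, ∃ m, ∀ a ∈ vanishingIdeal q i,
      (pullbackSubOne hf hq ^ m) a ∈ vanishingIdeal q (i + 1) := by
    intro i
    induction i with
    | zero => exact ⟨1, h0⟩
    | succ i ih =>
      obtain ⟨m, hm⟩ := ih
      refine ⟨m + r, fun a ha => ?_⟩
      obtain ⟨P, hP⟩ := exists_polyFn_sub_mem a (i + 1 + 1)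
      have hPi : polyFn q P ∈ vanishingIdeal q (i + 1) := by
        have := sub_mem ha (vanishingIdeal_anti q (Nat.le_succ (i + 1)) hP)
        simpa using this
      rw [polyFn_mem_iff, pow_succ] at hPi
      have h2 : (pullbackSubOne hf hq ^ (m + r)) (polyFn q P) ∈
          vanishingIdeal q (i + 1 + 1) := by
        refine Submodule.mul_induction_on hPi (fun A hA B hB => ?_) (fun A B hA hB => ?_)
        · have hA' := polyFn_mem_of_mem_pow (q := q) hA
          have hB' : polyFn q B ∈ vanishingIdeal q 1 :=
            polyFn_mem_of_mem_pow (by rwa [pow_one])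
          rw [map_mul]
          exact pullback_sub_one_pow_mul_mem hf hq m r hA' hB' (hm _ hA') (h1 _ hB')
        · rw [map_add, map_add]; exact add_mem hA hB
      have h3 := add_mem (pullback_sub_one_pow_mem hf hq hP (m + r)) h2
      rw [← map_add, sub_add_cancel] at h3
      exact h3
  induction k with
  | zero => exact ⟨0, fun a => by rw [vanishingIdeal_zero]; trivial⟩
  | succ k ih =>
    obtain ⟨m, hm⟩ := ih
    obtain ⟨s, hs⟩ := hstep k
    refine ⟨s + m, fun a => ?_⟩
    rw [pow_add, Module.End.mul_apply]
    exact hs _ (hm a)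

theorem pow_sub_one_pow_eq_zero {p : ℕ} (A : Module.End ℂ (Fin n → ℂ))
    (h : ∀ μ, A.HasEigenvalue μ → μ ^ p = 1) : ∃ r, (A ^ p - 1) ^ r = 0 := by
  classical
  set m := minpoly ℂ A
  have hm0 : m ≠ 0 := minpoly.ne_zero (Algebra.IsIntegral.isIntegral _)
  have hdvd : ∀ s : Multiset ℂ, (∀ μ ∈ s, μ ^ p = 1) →
      (s.map fun μ => X - C μ).prod ∣ (X ^ p - 1 : ℂ[X]) ^ s.card := by
    intro s
    induction s using Multiset.induction_on with
    | empty => intro _; simp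
    | cons μ s ih =>
      intro hs
      rw [Multiset.map_cons, Multiset.prod_cons, Multiset.card_cons, pow_succ']
      refine mul_dvd_mul ?_ (ih fun ν hν => hs ν (Multiset.mem_cons_of_mem hν))
      rw [dvd_iff_isRoot]
      simp [hs μ (Multiset.mem_cons_self _ _)]
  have hmd : m ∣ (X ^ p - 1 : ℂ[X]) ^ m.roots.card := by
    have hsp : m = (m.roots.map fun μ => X - C μ).prod :=
      (IsAlgClosed.splits m).eq_prod_roots_of_monic
        (minpoly.monic (Algebra.IsIntegral.isIntegral _))
    conv_lhs => rw [hsp]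
    refine hdvd _ fun μ hμ => h μ ?_
    rw [Module.End.hasEigenvalue_iff_isRoot]
    exact (mem_roots hm0).1 hμ
  refine ⟨m.roots.card, ?_⟩
  obtain ⟨t, ht⟩ := hmd
  have := congrArg (aeval A) ht
  rw [map_mul, minpoly.aeval, zero_mul] at this
  simpa using this

theorem pullback_pow_apply (N : ℕ) (a : analyticAlg q) (x : Fin n → ℂ) :
    (((pullback hf hq).toLinearMap ^ N) a).1 x = a.1 (f^[N] x) := by
  induction N generalizing x with
  | zero => rfl
  | succ N ih =>
    rw [pow_succ', Module.End.mul_apply, Function.iterate_succ_apply, ← ih]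
    rfl

theorem analyticAt_iterate (hf : AnalyticAt ℂ f q) (hq : f q = q) (N : ℕ) :
    AnalyticAt ℂ f^[N] q := by
  induction N with
  | zero => exact analyticAt_id
  | succ N ih =>
    rw [Function.iterate_succ]
    exact AnalyticAt.comp (by rwa [hq]) hf

/-- A local diffeomorphism with `n` functionally independent first integrals has finite order: some
iterate is tangent to a unipotent map, and the logarithm of its action on jets is a derivation,
which vanishes up to high order. -/
theorem exists_iterate_eventually_eq_id (hf : AnalyticAt ℂ f q) (hq : f q = q)
    (hdet : (fderiv ℂ f q).det ≠ 0)
    {G H : Fin n → (Fin n → ℂ) → ℂ} (hint : ∀ i, IsMeromorphicFirstIntegral f q (G i) (H i))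
    (hind : FunctionallyIndependentAt q G H) :
    ∃ p : ℕ, 0 < p ∧ ∀ᶠ x in 𝓝 q, f^[p] x = x := by
  obtain ⟨p, hp0, hp⟩ := exists_pow_eq_one hf hq hdet hint hind
  refine ⟨p, hp0, ?_⟩
  have hg := analyticAt_iterate hf hq p
  have hgq : f^[p] q = q := Function.iterate_fixed hq p
  have hTp : (pullback hg hgq).toLinearMap = (pullback hf hq).toLinearMap ^ p := by
    ext1 a
    apply Subtype.ext
    funext x
    rw [pullback_pow_apply]
    rfl
  have haev : ∀ r : ℂ[X], aeval (pullback hg hgq).toLinearMap r =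
      aeval (pullback hf hq).toLinearMap (r.comp (X ^ p)) := by
    intro r
    rw [aeval_comp, map_pow, aeval_X, hTp]
  obtain ⟨r, hr⟩ := pow_sub_one_pow_eq_zero (fderiv ℂ f q : (Fin n → ℂ) →ₗ[ℂ] (Fin n → ℂ)) hp
  have hr' : (fderiv ℂ f^[p] q - 1) ^ r = 0 := by
    have hd : fderiv ℂ f^[p] q = fderiv ℂ f q ^ p :=
      (hf.differentiableAt.hasFDerivAt.iterate hq p).fderiv
    rw [hd]
    apply ContinuousLinearMap.coe_injective
    have hc : ∀ (B : (Fin n → ℂ) →L[ℂ] (Fin n → ℂ)) (N : ℕ),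
        ((B ^ N : (Fin n → ℂ) →L[ℂ] (Fin n → ℂ)) : Module.End ℂ (Fin n → ℂ)) =
          (B : Module.End ℂ (Fin n → ℂ)) ^ N :=
      fun B N => map_pow (ContinuousLinearMap.toLinearMapRingHom (R₁ := ℂ) (M₁ := Fin n → ℂ)) B N
    rw [hc]
    rw [← hc] at hr
    exact hr
  obtain ⟨d, hd⟩ := exists_order_bound hf hq hdet hint hind
  have hmain : ∀ k a, pullback hg hgq a - a ∈ vanishingIdeal q k := by
    intro k a
    obtain ⟨m, hm⟩ := exists_pullback_sub_one_pow_mem hg hgq hr' (k + d + 1)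
    have hpow : ((jetMap hg hgq (k + d + 1)).toLinearMap - 1) ^ m = 0 := by
      ext1 v
      obtain ⟨b, rfl⟩ := toJet_surjective q _ v
      have h1 := aeval_jetMap_toJet hg hgq (k + d + 1) ((X - 1) ^ m) b
      simp only [map_pow, map_sub, aeval_X, map_one] at h1
      rw [h1, LinearMap.zero_apply]
      exact toJet_eq_zero_iff.2 (hm b)
    obtain ⟨s, t, hleib, hst⟩ := exists_leibniz_of_unipotent _ hpow
    have hl := leibniz_of_jetMap hg hgq hleib
    simp only [haev] at hl
    have h2 := hd k _ hl
    simp only [← haev] at h2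
    have h3 : toJet q (k + d + 1) (pullback hg hgq a - a) =
        toJet q (k + d + 1) (aeval (pullback hg hgq).toLinearMap (t * s) a) := by
      rw [← aeval_jetMap_toJet, map_mul, ← hst, map_sub]
      rfl
    have h4 := vanishingIdeal_anti q (show k ≤ k + d + 1 by omega) (toJet_eq_iff.1 h3)
    have h5 : aeval (pullback hg hgq).toLinearMap (t * s) a ∈ vanishingIdeal q k := by
      rw [map_mul, Module.End.mul_apply]
      exact aeval_pullback_mem hg hgq t (h2 a)
    have := add_mem h4 h5
    rwa [sub_add_cancel] at this
  have hcoord : ∀ j, ∀ᶠ x in 𝓝 q, f^[p] x j = x j := by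
    intro j
    filter_upwards [eventually_eq_zero_of_forall_mem fun k => hmain k (coordFn q j)] with x hx
    have h1 : (f^[p] x j - q j) - (x j - q j) = 0 := hx
    linear_combination h1
  filter_upwards [eventually_all.2 hcoord] with x hx
  exact funext hx

end Unipotent

end MeroInt
namespace MeroInt

/-! ### Fixed points of integrable maps -/

section FixedPoints

variable {n : ℕ} {U : Set (Fin n → ℂ)} {q : Fin n → ℂ} {f : (Fin n → ℂ) → (Fin n → ℂ)}

theorem fderiv_pow_eq_one_of_iterate {p : ℕ} (hf : DifferentiableAt ℂ f q) (hq : f q = q)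
    (hp : ∀ᶠ x in 𝓝 q, f^[p] x = x) : fderiv ℂ f q ^ p = 1 := by
  have h1 : HasFDerivAt f^[p] (fderiv ℂ f q ^ p) q := hf.hasFDerivAt.iterate hq p
  have h2 : HasFDerivAt f^[p] (1 : (Fin n → ℂ) →L[ℂ] (Fin n → ℂ)) q :=
    (hasFDerivAt_id q).congr_of_eventuallyEq hp
  exact h1.unique h2

theorem pow_eq_one_of_hasEigenvalue {p : ℕ} (h : fderiv ℂ f q ^ p = 1) {μ : ℂ}
    (hμ : IsEigenvalueAt f q μ) : μ ^ p = 1 := by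
  obtain ⟨v, hv⟩ := hμ.exists_hasEigenvector
  have h1 : ∀ N : ℕ, (fderiv ℂ f q ^ N) v = μ ^ N • v := by
    intro N
    induction N with
    | zero => simp
    | succ N ih =>
      have h2 : fderiv ℂ f q v = μ • v := hv.apply_eq_smul
      rw [pow_succ', mul_apply_eq_comp, ih, map_smul, h2, smul_smul, pow_succ]
  have h2 := h1 p
  rw [h, one_apply_eq_self] at h2
  have h3 : (μ ^ p - 1) • v = 0 := by rw [sub_smul, one_smul, ← h2, sub_self]
  exact sub_eq_zero.1 ((smul_eq_zero.1 h3).resolve_right hv.2)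

theorem IsIntegrableMap.exists_pow_eq_one (hU : IsIntegrableMap U f) (hqU : q ∈ U) (hq : f q = q) :
    ∃ p : ℕ, 0 < p ∧ ∀ μ : ℂ, IsEigenvalueAt f q μ → μ ^ p = 1 := by
  obtain ⟨G, H, hint, hind⟩ := hU.integrals q hqU hq
  exact MeroInt.exists_pow_eq_one (hU.analytic q hqU) hq (hU.invertible q hqU hq) hint hind

theorem IsIntegrableMap.exists_iterate_eq (hU : IsIntegrableMap U f) (hqU : q ∈ U) (hq : f q = q) :
    ∃ p : ℕ, 0 < p ∧ ∀ᶠ x in 𝓝 q, f^[p] x = x := by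
  obtain ⟨G, H, hint, hind⟩ := hU.integrals q hqU hq
  exact exists_iterate_eventually_eq_id (hU.analytic q hqU) hq (hU.invertible q hqU hq) hint hind

/-- An entire map of finite order near one fixed point has the same finite order everywhere, by the
identity theorem. -/
theorem IsIntegrableMap.exists_polynomial_of_entire (hU : IsIntegrableMap Set.univ f) :
    ∃ P : Polynomial ℂ, P ≠ 0 ∧
      ∀ q : Fin n → ℂ, f q = q → ∀ μ : ℂ, IsEigenvalueAt f q μ → P.eval μ = 0 := by
  by_cases hex : ∃ q, f q = q
  · obtain ⟨q, hq⟩ := hex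
    obtain ⟨p, hp0, hp⟩ := hU.exists_iterate_eq (Set.mem_univ q) hq
    have han : ∀ N : ℕ, AnalyticOnNhd ℂ f^[N] Set.univ := by
      intro N
      induction N with
      | zero => exact analyticOnNhd_id
      | succ N ih =>
        rw [Function.iterate_succ]
        exact ih.comp hU.analytic (Set.mapsTo_univ _ _)
    have hid : f^[p] = id := (han p).eq_of_eventuallyEq analyticOnNhd_id hp
    refine ⟨Polynomial.X ^ p - 1, Polynomial.X_pow_sub_C_ne_zero hp0 1, fun q' hq' μ hμ => ?_⟩
    have h1 := fderiv_pow_eq_one_of_iterate (p := p)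
      (hU.analytic q' (Set.mem_univ _)).differentiableAt hq'
      (Eventually.of_forall fun x => congrFun hid x)
    simp [pow_eq_one_of_hasEigenvalue h1 hμ]
  · exact ⟨1, one_ne_zero, fun q hq => (hex ⟨q, hq⟩).elim⟩

/-- A map of finite order is linearizable, so that an isolated fixed point is nondegenerate. -/
theorem not_hasEigenvalue_one_of_iterate {p : ℕ} (hp0 : 0 < p) (hf : AnalyticAt ℂ f q)
    (hq : f q = q) (hp : ∀ᶠ x in 𝓝 q, f^[p] x = x) (hiso : ∀ᶠ x in 𝓝 q, f x = x → x = q) :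
    ¬ IsEigenvalueAt f q 1 := by
  intro hone
  obtain ⟨v, hv⟩ := hone.exists_hasEigenvector
  set A := fderiv ℂ f q with hA
  have hAv : A v = v := by
    have := hv.apply_eq_smul
    rwa [one_smul] at this
  have hAp : A ^ p = 1 := fderiv_pow_eq_one_of_iterate hf.differentiableAt hq hp
  -- averaging along the orbit gives a coordinate `h` with `h ∘ f = A ∘ h`
  set h : (Fin n → ℂ) → (Fin n → ℂ) :=
    fun x => ∑ i ∈ Finset.range p, (A ^ (p - 1 - i)) (f^[i] x - q) with hh
  have hhq : h q = 0 := by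
    refine Finset.sum_eq_zero fun i _ => ?_
    rw [Function.iterate_fixed hq, sub_self, map_zero]
  have hconj : ∀ᶠ x in 𝓝 q, h (f x) = A (h x) := by
    filter_upwards [hp] with x hx
    set u : ℕ → (Fin n → ℂ) := fun i => (A ^ (p - i)) (f^[i] x - q) with hu
    have e1 : h (f x) = ∑ i ∈ Finset.range p, u (i + 1) := by
      refine Finset.sum_congr rfl fun i _ => ?_
      simp only [hu]
      rw [← Function.iterate_succ_apply, show p - (i + 1) = p - 1 - i by omega]
    have e2 : A (h x) = ∑ i ∈ Finset.range p, u i := by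
      rw [hh, map_sum]
      refine Finset.sum_congr rfl fun i hi => ?_
      have hi' := Finset.mem_range.1 hi
      simp only [hu]
      rw [show p - i = (p - 1 - i) + 1 by omega, pow_succ', mul_apply_eq_comp]
    have e3 : u p = u 0 := by
      simp only [hu, Nat.sub_self, Nat.sub_zero, pow_zero, hAp, hx, Function.iterate_zero, id]
    have e4 := Finset.sum_range_succ u p
    rw [Finset.sum_range_succ', e3] at e4
    rw [e1, e2]
    exact add_right_cancel e4
  set B : (Fin n → ℂ) →L[ℂ] (Fin n → ℂ) := (p : ℂ) • A ^ (p - 1) with hB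
  have hstrict : HasStrictFDerivAt h B q := by
    have h1 : ∀ i ∈ Finset.range p, HasStrictFDerivAt (fun x => (A ^ (p - 1 - i)) (f^[i] x - q))
        (A ^ (p - 1)) q := by
      intro i hi
      have hi' := Finset.mem_range.1 hi
      have h2 : HasStrictFDerivAt f^[i] (A ^ i) q := hf.hasStrictFDerivAt.iterate hq i
      have h3 := (A ^ (p - 1 - i)).hasStrictFDerivAt.comp q (h2.sub_const q)
      have h4 : (A ^ (p - 1 - i)).comp (A ^ i) = A ^ (p - 1) := by
        rw [← ContinuousLinearMap.mul_def, ← pow_add]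
        congr 1
        omega
      rw [h4] at h3
      exact h3
    have h5 := HasStrictFDerivAt.fun_sum h1
    rw [Finset.sum_const, Finset.card_range, ← Nat.cast_smul_eq_nsmul ℂ] at h5
    exact h5
  have hdet : B.det ≠ 0 := by
    have h1 : B * ((p : ℂ)⁻¹ • A) = 1 := by
      refine ContinuousLinearMap.ext fun w => ?_
      change (p : ℂ) • (A ^ (p - 1)) ((p : ℂ)⁻¹ • A w) = w
      rw [map_smul, smul_smul, mul_inv_cancel₀ (by exact_mod_cast hp0.ne'), one_smul,
        ← mul_apply_eq_comp, ← pow_succ, show p - 1 + 1 = p by omega, hAp, one_apply_eq_self]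
    have h2 : B.det * ((p : ℂ)⁻¹ • A).det = 1 := by
      have := congrArg (fun C : (Fin n → ℂ) →L[ℂ] (Fin n → ℂ) =>
        LinearMap.det (C : (Fin n → ℂ) →ₗ[ℂ] (Fin n → ℂ))) h1
      have h3 : LinearMap.det ((B : Module.End ℂ (Fin n → ℂ)) *
          (((p : ℂ)⁻¹ • A : (Fin n → ℂ) →L[ℂ] (Fin n → ℂ)) : Module.End ℂ (Fin n → ℂ))) = 1 := by
        refine this.trans ?_
        exact LinearMap.det_id
      rw [map_mul] at h3
      exact h3
    exact left_ne_zero_of_mul_eq_one h2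
  have hs : HasStrictFDerivAt h
      (B.toContinuousLinearEquivOfDetNeZero hdet : (Fin n → ℂ) →L[ℂ] (Fin n → ℂ)) q := by
    rw [ContinuousLinearMap.coe_toContinuousLinearEquivOfDetNeZero]; exact hstrict
  set g := hs.localInverse h _ q with hg
  have hleft : ∀ᶠ x in 𝓝 q, g (h x) = x := hs.eventually_left_inverse
  have hright := hs.eventually_right_inverse
  have hgt := hs.localInverse_tendsto
  rw [hhq] at hright hgt
  have hft : Tendsto f (𝓝 q) (𝓝 q) := tendsto_of_fixed hf hq
  have hst : Tendsto (fun s : ℂ => s • v) (𝓝[≠] 0) (𝓝 0) := by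
    have : Continuous fun s : ℂ => s • v := by fun_prop
    simpa using (this.tendsto 0).mono_left nhdsWithin_le_nhds
  have hyt : Tendsto (fun s : ℂ => g (s • v)) (𝓝[≠] 0) (𝓝 q) := hgt.comp hst
  have hev := (hst.eventually hright).and ((hyt.eventually hconj).and
    ((hyt.eventually hiso).and ((hyt.eventually hleft).and
      (((hft.comp hyt).eventually hleft).and self_mem_nhdsWithin))))
  obtain ⟨s, h1, h2, h3, h4, h5, h6⟩ := hev.exists
  have h7 : h (f (g (s • v))) = h (g (s • v)) := by
    rw [h2, h1, map_smul, hAv]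
  have h8 : f (g (s • v)) = g (s • v) := by
    have h5' : g (h (f (g (s • v)))) = f (g (s • v)) := h5
    rw [h7, h4] at h5'
    exact h5'.symm
  have h9 := h3 h8
  have h10 : h (g (s • v)) = s • v := h1
  rw [h9, hhq] at h10
  rcases smul_eq_zero.1 h10.symm with h11 | h11
  · exact h6 h11
  · exact hv.2 h11

theorem IsIntegrableMap.not_hasEigenvalue_one (hU : IsIntegrableMap U f) (hqU : q ∈ U)
    (hq : f q = q) : ¬ IsEigenvalueAt f q 1 := by
  obtain ⟨p, hp0, hp⟩ := hU.exists_iterate_eq hqU hq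
  exact not_hasEigenvalue_one_of_iterate hp0 (hU.analytic q hqU) hq hp (hU.isolated q hqU hq)

end FixedPoints

end MeroInt
namespace MeroInt

/-! ### Elimination by successive resultants -/

section EliminationTheory

variable {K : Type} [Field K] {Ω : Type*} [Field Ω] (φ : Polynomial K →+* Ω)

/-- The `K`-subspace of the polynomials that vanish at the point `y`, where the coefficients are
specialized by `φ`. -/
noncomputable def vanishingAt {m : ℕ} (y : Fin m → Ω) :
    Submodule K (MvPolynomial (Fin m) (Polynomial K)) where
  carrier := {A | MvPolynomial.eval₂Hom φ y A = 0}
  add_mem' ha hb := by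
    simp only [Set.mem_ofPred_eq] at ha hb ⊢
    rw [map_add, ha, hb, add_zero]
  zero_mem' := map_zero _
  smul_mem' c a ha := by
    simp only [Set.mem_ofPred_eq] at ha ⊢
    rw [Algebra.smul_def, map_mul, ha, mul_zero]

theorem mem_vanishingAt {m : ℕ} {y : Fin m → Ω} {A : MvPolynomial (Fin m) (Polynomial K)} :
    A ∈ vanishingAt φ y ↔ MvPolynomial.eval₂Hom φ y A = 0 := Iff.rfl

theorem eval₂Hom_cons {m : ℕ} (t : Ω) (y : Fin m → Ω)
    (A : MvPolynomial (Fin (m + 1)) (Polynomial K)) :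
    MvPolynomial.eval₂Hom φ (Fin.cons t y : Fin (m + 1) → Ω) A =
      ((MvPolynomial.finSuccEquiv (Polynomial K) m A).map (MvPolynomial.eval₂Hom φ y)).eval t := by
  have : MvPolynomial.eval₂Hom φ (Fin.cons t y : Fin (m + 1) → Ω) =
      ((Polynomial.evalRingHom t).comp (Polynomial.mapRingHom (MvPolynomial.eval₂Hom φ y))).comp
        (MvPolynomial.finSuccEquiv (Polynomial K) m : MvPolynomial (Fin (m + 1)) (Polynomial K) →+*
          Polynomial (MvPolynomial (Fin m) (Polynomial K))) := by
    apply MvPolynomial.ringHom_ext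
    · intro r
      simp [MvPolynomial.finSuccEquiv_apply]
    · intro i
      refine Fin.cases ?_ (fun j => ?_) i
      · simp [MvPolynomial.finSuccEquiv_apply]
      · simp [MvPolynomial.finSuccEquiv_apply]
  exact DFunLike.congr_fun this A

theorem eval₂Hom_rename_succ {m : ℕ} (t : Ω) (y : Fin m → Ω)
    (A : MvPolynomial (Fin m) (Polynomial K)) :
    MvPolynomial.eval₂Hom φ (Fin.cons t y : Fin (m + 1) → Ω) (MvPolynomial.rename Fin.succ A) =
      MvPolynomial.eval₂Hom φ y A := by
  rw [MvPolynomial.coe_eval₂Hom, MvPolynomial.eval₂_rename]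
  rfl

theorem eval₂Hom_changeUnknowns {m : ℕ} (M : Matrix (Fin m) (Fin m) K) (y : Fin m → Ω)
    (A : MvPolynomial (Fin m) (Polynomial K)) :
    MvPolynomial.eval₂Hom φ y (changeUnknowns M A) =
      MvPolynomial.eval₂Hom φ ((M.map (φ.comp Polynomial.C)).mulVec y) A := by
  have : (MvPolynomial.eval₂Hom φ y).comp (changeUnknowns M :
      MvPolynomial (Fin m) (Polynomial K) →+* MvPolynomial (Fin m) (Polynomial K)) =
      MvPolynomial.eval₂Hom φ ((M.map (φ.comp Polynomial.C)).mulVec y) := by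
    apply MvPolynomial.ringHom_ext
    · intro r
      simp [changeUnknowns]
    · intro i
      simp [changeUnknowns, Matrix.mulVec, dotProduct]
  exact DFunLike.congr_fun this A

theorem eliminateFirst_subset_vanishingAt {m : ℕ}
    {S : Set (MvPolynomial (Fin (m + 1)) (Polynomial K))} {t : Ω} {y : Fin m → Ω}
    (h : S ⊆ vanishingAt φ (Fin.cons t y : Fin (m + 1) → Ω)) :
    eliminateFirst S ⊆ vanishingAt φ y := by
  have hspan := Submodule.span_le.2 h
  rintro r (⟨A, hA, B, hB, hdeg, rfl⟩ | hr)
  · obtain ⟨p, r, -, -, hpr⟩ := Polynomial.exists_mul_add_mul_eq_C_resultant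
      (MvPolynomial.finSuccEquiv (Polynomial K) m A) (MvPolynomial.finSuccEquiv (Polynomial K) m B)
      le_rfl le_rfl (Or.inl hdeg.ne')
    have h1 := congrArg (fun P => (P.map (MvPolynomial.eval₂Hom φ y)).eval t) hpr
    simp only [Polynomial.map_add, Polynomial.map_mul, Polynomial.eval_add, Polynomial.eval_mul,
      Polynomial.map_C, Polynomial.eval_C] at h1
    rw [← eval₂Hom_cons, ← eval₂Hom_cons, (mem_vanishingAt φ).1 (hspan hA),
      (mem_vanishingAt φ).1 (hspan hB), zero_mul, zero_mul, add_zero] at h1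
    exact h1.symm
  · have := hspan hr
    rw [mem_vanishingAt, eval₂Hom_rename_succ] at this
    exact this

/-- Every polynomial obtained by successive resultants vanishes at the common zeros of the
system. -/
theorem ObtainedByResultants.map_eq_zero {m : ℕ}
    {S : Set (MvPolynomial (Fin m) (Polynomial K))} {P : Polynomial K}
    (hP : ObtainedByResultants m S P) {y : Fin m → Ω} (h : S ⊆ vanishingAt φ y) : φ P = 0 := by
  induction m with
  | zero =>
    have := h hP
    simpa [vanishingAt] using this
  | succ m ih =>
    obtain ⟨M, hM, hP⟩ := hP
    set M' := M.map (φ.comp Polynomial.C) with hM'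
    have hu : IsUnit M'.det := by
      have h1 := hM.map (φ.comp Polynomial.C)
      rw [RingHom.map_det] at h1
      exact h1
    set z := M'⁻¹.mulVec y with hz
    have hMz : M'.mulVec z = y := by
      rw [hz, Matrix.mulVec_mulVec, Matrix.mul_nonsing_inv _ hu, Matrix.one_mulVec]
    refine ih hP (y := Fin.tail z) (eliminateFirst_subset_vanishingAt φ (t := z 0) ?_)
    rintro _ ⟨A, hA, rfl⟩
    rw [Fin.cons_self_tail, SetLike.mem_coe, mem_vanishingAt, eval₂Hom_changeUnknowns, hMz]
    exact h hA

/-- Restriction of a polynomial to a line: the coefficient of the top power is the value of the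
leading form at the direction of the line. -/
theorem eval₂Hom_line {R R' σ : Type*} [CommRing R] [CommRing R'] [Fintype σ] (ψ : R →+* R')
    (v w : σ → R') (A : MvPolynomial σ R) {e : ℕ} (he : A.totalDegree ≤ e) :
    (MvPolynomial.eval₂Hom (Polynomial.C.comp ψ)
      (fun i => Polynomial.C (v i) * Polynomial.X + Polynomial.C (w i)) A).natDegree ≤ e ∧
    (MvPolynomial.eval₂Hom (Polynomial.C.comp ψ)
      (fun i => Polynomial.C (v i) * Polynomial.X + Polynomial.C (w i)) A).coeff e =
        MvPolynomial.eval₂Hom ψ v (MvPolynomial.homogeneousComponent e A) := by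
  classical
  set l : σ → Polynomial R' := fun i => Polynomial.C (v i) * Polynomial.X + Polynomial.C (w i)
  have hl : ∀ i, (l i).natDegree ≤ 1 := fun i => Polynomial.natDegree_linear_le
  have hpow : ∀ (d : σ →₀ ℕ) i, (l i ^ d i).natDegree ≤ d i := fun d i => by
    simpa using Polynomial.natDegree_pow_le_of_le (d i) (hl i)
  have hprod : ∀ d : σ →₀ ℕ, (∏ i, l i ^ d i).natDegree ≤ ∑ i, d i := fun d =>
    (Polynomial.natDegree_prod_le _ _).trans (Finset.sum_le_sum fun i _ => hpow d i)
  have hcoeff' : ∀ (d : σ →₀ ℕ) (s : Finset σ),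
      (∏ i ∈ s, l i ^ d i).coeff (∑ i ∈ s, d i) = ∏ i ∈ s, v i ^ d i := fun d s => by
    induction s using Finset.induction_on with
    | empty => simp
    | insert a s ha ih =>
      rw [Finset.prod_insert ha, Finset.sum_insert ha, Finset.prod_insert ha,
        Polynomial.coeff_mul_add_eq_of_natDegree_le (hpow d a)
          ((Polynomial.natDegree_prod_le _ _).trans (Finset.sum_le_sum fun i _ => hpow d i)), ih]
      have := Polynomial.coeff_pow_of_natDegree_le (m := d a) (hl a)
      rw [mul_one] at this
      rw [this]
      simp [l]
  have hcoeff : ∀ d : σ →₀ ℕ, (∏ i, l i ^ d i).coeff (∑ i, d i) = ∏ i, v i ^ d i :=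
    fun d => hcoeff' d _
  have hsupp : ∀ d ∈ A.support, ∑ i, d i ≤ e := fun d hd => by
    have := MvPolynomial.le_totalDegree hd
    rw [Finsupp.sum_fintype _ _ (fun _ => rfl)] at this
    exact this.trans he
  have hexp : MvPolynomial.eval₂Hom (Polynomial.C.comp ψ) l A =
      ∑ d ∈ A.support, Polynomial.C (ψ (A.coeff d)) * ∏ i, l i ^ d i := by
    rw [MvPolynomial.coe_eval₂Hom, MvPolynomial.eval₂_eq']
    rfl
  rw [hexp]
  constructor
  · refine Polynomial.natDegree_sum_le_of_forall_le _ _ fun d hd => ?_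
    exact (Polynomial.natDegree_C_mul_le _ _).trans ((hprod d).trans (hsupp d hd))
  · rw [MvPolynomial.homogeneousComponent_apply, map_sum, Polynomial.finsetSum_coeff,
      Finset.sum_filter]
    refine Finset.sum_congr rfl fun d hd => ?_
    have hdeg : d.degree = ∑ i, d i := Finsupp.degree_eq_sum d
    rw [Polynomial.coeff_C_mul]
    split_ifs with h
    · rw [hdeg] at h
      rw [← h, hcoeff, MvPolynomial.coe_eval₂Hom, MvPolynomial.eval₂_monomial,
        Finsupp.prod_fintype _ _ (fun _ => pow_zero _)]
    · rw [Polynomial.coeff_eq_zero_of_natDegree_lt, mul_zero]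
      rw [hdeg] at h
      exact lt_of_le_of_lt (hprod d) (lt_of_le_of_ne (hsupp d hd) h)

theorem exists_matrix_col_eq {m : ℕ} {v : Fin (m + 1) → K} (hv : v ≠ 0) :
    ∃ M : Matrix (Fin (m + 1)) (Fin (m + 1)) K, IsUnit M.det ∧ ∀ i, M i 0 = v i := by
  obtain ⟨k, hk⟩ := Function.ne_iff.1 hv
  set Q : Matrix (Fin (m + 1)) (Fin (m + 1)) K := (Equiv.swap 0 k).permMatrix K with hQ
  refine ⟨Q.updateCol 0 v, ?_, fun i => Matrix.updateCol_self⟩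
  have h1 := congrFun (Matrix.mulVec_cramer Q v) k
  have h2 : (Q.mulVec (Q.cramer v)) k = Q.cramer v 0 := by
    rw [hQ, Matrix.permMatrix_mulVec]
    simp
  rw [h2, Matrix.cramer_apply] at h1
  rw [h1, isUnit_iff_ne_zero, Pi.smul_apply, smul_eq_mul]
  refine mul_ne_zero ?_ hk
  rw [hQ, Matrix.det_permutation]
  rcases Int.units_eq_one_or (Equiv.Perm.sign (Equiv.swap 0 k)) with h | h <;> simp [h]

theorem exists_eval_C_ne_zero [Infinite K] {m : ℕ} {A : MvPolynomial (Fin m) (Polynomial K)}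
    (hA : A ≠ 0) : ∃ v : Fin m → K, MvPolynomial.eval (fun i => Polynomial.C (v i)) A ≠ 0 := by
  by_contra! h
  apply hA
  refine MvPolynomial.funext_set (fun _ => Set.range (Polynomial.C : K → Polynomial K))
    (fun _ => Set.infinite_range_of_injective Polynomial.C_injective) fun x hx => ?_
  choose v hv using fun i => hx i (Set.mem_univ i)
  have : x = fun i => Polynomial.C (v i) := funext fun i => (hv i).symm
  rw [this, h, map_zero]

theorem finSuccEquiv_changeUnknowns {m : ℕ} (M : Matrix (Fin (m + 1)) (Fin (m + 1)) K)
    (A : MvPolynomial (Fin (m + 1)) (Polynomial K)) :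
    MvPolynomial.finSuccEquiv (Polynomial K) m (changeUnknowns M A) =
      MvPolynomial.eval₂Hom (Polynomial.C.comp MvPolynomial.C)
        (fun i => Polynomial.C (MvPolynomial.C (Polynomial.C (M i 0))) * Polynomial.X +
          Polynomial.C (∑ j, MvPolynomial.C (Polynomial.C (M i (Fin.succ j))) * MvPolynomial.X j))
        A := by
  have : (MvPolynomial.finSuccEquiv (Polynomial K) m : MvPolynomial (Fin (m + 1)) (Polynomial K) →+*
          Polynomial (MvPolynomial (Fin m) (Polynomial K))).comp
      (changeUnknowns M : MvPolynomial (Fin (m + 1)) (Polynomial K) →+*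
        MvPolynomial (Fin (m + 1)) (Polynomial K)) =
      MvPolynomial.eval₂Hom (Polynomial.C.comp MvPolynomial.C)
        (fun i => Polynomial.C (MvPolynomial.C (Polynomial.C (M i 0))) * Polynomial.X +
          Polynomial.C (∑ j, MvPolynomial.C (Polynomial.C (M i (Fin.succ j))) *
            MvPolynomial.X j)) := by
    apply MvPolynomial.ringHom_ext
    · intro r
      simp [changeUnknowns, MvPolynomial.finSuccEquiv_apply]
    · intro i
      simp [changeUnknowns, MvPolynomial.finSuccEquiv_apply, Fin.sum_univ_succ]
  exact DFunLike.congr_fun this A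

/-- After a generic linear change of the unknowns, a nonconstant polynomial has, in the first
unknown, a constant leading coefficient. -/
theorem exists_changeUnknowns_leadingCoeff [Infinite K] {m : ℕ}
    {A : MvPolynomial (Fin (m + 1)) (Polynomial K)} (hA : 0 < A.totalDegree) :
    ∃ M : Matrix (Fin (m + 1)) (Fin (m + 1)) K, IsUnit M.det ∧ ∃ c : Polynomial K, c ≠ 0 ∧
      (MvPolynomial.finSuccEquiv (Polynomial K) m (changeUnknowns M A)).natDegree ≤ A.totalDegree ∧
      (MvPolynomial.finSuccEquiv (Polynomial K) m (changeUnknowns M A)).coeff A.totalDegree =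
        MvPolynomial.C c := by
  set e := A.totalDegree with he
  have htop : MvPolynomial.homogeneousComponent e A ≠ 0 := by
    have hne : A.support.Nonempty := by
      rw [Finset.nonempty_iff_ne_empty, Ne, MvPolynomial.support_eq_empty]
      rintro rfl
      simp [he] at hA
    obtain ⟨d, hd, hde⟩ := Finset.exists_mem_eq_sup _ hne fun s : Fin (m + 1) →₀ ℕ =>
      s.sum fun _ e => e
    intro h0
    have h1 := congrArg (MvPolynomial.coeff d) h0
    rw [MvPolynomial.coeff_homogeneousComponent, if_pos, MvPolynomial.coeff_zero] at h1
    · exact MvPolynomial.mem_support_iff.1 hd h1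
    · exact hde.symm
  obtain ⟨v, hv⟩ := exists_eval_C_ne_zero htop
  have hv0 : v ≠ 0 := by
    rintro rfl
    apply hv
    have h1 : (fun i => Polynomial.C ((0 : Fin (m + 1) → K) i)) = 0 := by
      funext i; simp
    rw [h1, MvPolynomial.eval_zero, MvPolynomial.constantCoeff_eq]
    refine (MvPolynomial.homogeneousComponent_isHomogeneous e A).coeff_eq_zero ?_
    simpa using hA.ne
  obtain ⟨M, hM, hMv⟩ := exists_matrix_col_eq hv0
  refine ⟨M, hM, _, hv, ?_⟩
  rw [finSuccEquiv_changeUnknowns]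
  refine ⟨(eval₂Hom_line _ _ _ A le_rfl).1, ?_⟩
  rw [(eval₂Hom_line _ _ _ A le_rfl).2]
  simp only [hMv]
  have h2 : MvPolynomial.eval₂Hom (MvPolynomial.C : Polynomial K →+* MvPolynomial (Fin m) _)
      (fun i => MvPolynomial.C (Polynomial.C (v i))) =
      (MvPolynomial.C).comp (MvPolynomial.eval fun i => Polynomial.C (v i)) := by
    apply MvPolynomial.ringHom_ext
    · intro r; simp
    · intro i; simp
  exact DFunLike.congr_fun h2 _

/-- A linear combination of elements of `T` that avoids finitely many subspaces, none of which
contains `T`. -/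
theorem exists_mem_span_forall_notMem [Infinite K] {V ι : Type*} [AddCommGroup V] [Module K V]
    {T : Set V} (W : ι → Submodule K V) (s : Finset ι) (h : ∀ t ∈ s, ¬ T ⊆ W t) :
    ∃ B ∈ Submodule.span K T, ∀ t ∈ s, B ∉ W t := by
  by_contra! hcon
  have hcover : ⋃ t : s, (((W t.1).comap (Submodule.span K T).subtype :
      Submodule K (Submodule.span K T)) : Set (Submodule.span K T)) = Set.univ := by
    rw [Set.eq_univ_iff_forall]
    intro B
    obtain ⟨t, ht, hBt⟩ := hcon B.1 B.2
    exact Set.mem_iUnion.2 ⟨⟨t, ht⟩, hBt⟩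
  obtain ⟨t, ht⟩ := Subspace.exists_eq_top_of_iUnion_eq_univ hcover
  refine h t.1 t.2 fun B hB => ?_
  have : (⟨B, Submodule.subset_span hB⟩ : Submodule.span K T) ∈
      (W t.1).comap (Submodule.span K T).subtype := by
    rw [ht]; trivial
  exact this

/-- If the specialization `p'` of `p` at a point has the same degree as `p` and the resultant of `p`
and `g` vanishes there, then `g` vanishes at a root of `p'`. -/
theorem exists_mem_roots_of_map_resultant_eq_zero {R F : Type*} [CommRing R] [Field F]
    [IsAlgClosed F] (ψ : R →+* F) {p g : Polynomial R} (hp0 : p.map ψ ≠ 0)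
    (hp : (p.map ψ).natDegree = p.natDegree) (h : ψ (Polynomial.resultant p g) = 0) :
    ∃ t ∈ (p.map ψ).roots, (g.map ψ).eval t = 0 := by
  rw [← Polynomial.resultant_map_map, ← hp,
    Polynomial.resultant_eq_prod_eval _ _ _ Polynomial.natDegree_map_le (IsAlgClosed.splits _),
    mul_eq_zero] at h
  rcases h with h | h
  · exact absurd h (pow_ne_zero _ (Polynomial.leadingCoeff_ne_zero.2 hp0))
  · rw [Multiset.prod_eq_zero_iff, Multiset.mem_map] at h
    exact h

variable [IsAlgClosed Ω]

/-- One elimination step: a system without common zeros remains so, after a generic linear change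
of the unknowns. If `A` has a constant leading coefficient, a generic linear combination `B` of the
equations avoids the finitely many zeros of `A` over a given point. -/
theorem exists_eliminateFirst_no_zero [Infinite K] (hφ : Function.Injective φ) {m : ℕ}
    {S : Set (MvPolynomial (Fin (m + 1)) (Polynomial K))}
    (hS : ∀ y : Fin (m + 1) → Ω, ¬ S ⊆ vanishingAt φ y) :
    ∃ M : Matrix (Fin (m + 1)) (Fin (m + 1)) K, IsUnit M.det ∧
      ∀ y : Fin m → Ω, ¬ eliminateFirst (changeUnknowns M '' S) ⊆ vanishingAt φ y := by
  classical
  obtain ⟨A, hAS, hA0⟩ : ∃ A ∈ S, A ≠ 0 := by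
    by_contra! h
    exact hS 0 fun A hA => by rw [h A hA]; exact Submodule.zero_mem _
  set e := A.totalDegree with he
  rcases Nat.eq_zero_or_pos e with he0 | hepos
  · obtain ⟨c, hc⟩ : ∃ c, A = MvPolynomial.C c :=
      ⟨_, MvPolynomial.totalDegree_eq_zero_iff_eq_C.1 he0⟩
    refine ⟨1, by simp, fun y hy => ?_⟩
    have h1 : MvPolynomial.C c ∈ eliminateFirst (changeUnknowns (1 : Matrix _ _ K) '' S) := by
      refine Or.inr (Submodule.subset_span ⟨A, hAS, ?_⟩)
      rw [hc]
      simp [changeUnknowns]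
    have h2 := hy h1
    rw [SetLike.mem_coe, mem_vanishingAt, MvPolynomial.eval₂Hom_C,
      map_eq_zero_iff _ hφ] at h2
    exact hA0 (by rw [hc, h2, map_zero])
  obtain ⟨M, hM, c, hc0, hpdeg⟩ := exists_changeUnknowns_leadingCoeff hepos
  refine ⟨M, hM, fun y hy => ?_⟩
  set T := changeUnknowns M '' S with hT
  set p := MvPolynomial.finSuccEquiv (Polynomial K) m (changeUnknowns M A) with hp
  have hpe : p.natDegree = e := by
    refine le_antisymm hpdeg.1 (Polynomial.le_natDegree_of_ne_zero ?_)
    rw [hpdeg.2]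
    exact fun h => hc0 (MvPolynomial.C_injective _ _ (by rw [h, map_zero]))
  set p' := p.map (MvPolynomial.eval₂Hom φ y) with hp'
  have hcoef : p'.coeff e = φ c := by
    rw [hp', Polynomial.coeff_map, hpdeg.2, MvPolynomial.eval₂Hom_C]
  have hφc : φ c ≠ 0 := fun h => hc0 ((map_eq_zero_iff _ hφ).1 h)
  have hp'e : p'.natDegree = e :=
    le_antisymm ((Polynomial.natDegree_map_le).trans hpdeg.1)
      (Polynomial.le_natDegree_of_ne_zero (by rw [hcoef]; exact hφc))
  -- no point above `y` is a common zero
  have hno : ∀ t : Ω, ¬ T ⊆ vanishingAt φ (Fin.cons t y : Fin (m + 1) → Ω) := by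
    intro t ht
    refine hS ((M.map (φ.comp Polynomial.C)).mulVec (Fin.cons t y)) fun B hB => ?_
    have := ht ⟨B, hB, rfl⟩
    rw [SetLike.mem_coe, mem_vanishingAt, eval₂Hom_changeUnknowns] at this
    exact this
  obtain ⟨B, hB, hBne⟩ := exists_mem_span_forall_notMem (T := T)
    (fun t : Ω => vanishingAt φ (Fin.cons t y : Fin (m + 1) → Ω)) p'.roots.toFinset
    fun t _ => hno t
  have hres := hy (Or.inl ⟨changeUnknowns M A, Submodule.subset_span ⟨A, hAS, rfl⟩, B, hB,
    by rw [← hp, hpe]; exact hepos, rfl⟩)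
  have hp'0 : p' ≠ 0 := fun h => by
    rw [h, Polynomial.coeff_zero] at hcoef
    exact hφc hcoef.symm
  obtain ⟨t, ht, h0⟩ := exists_mem_roots_of_map_resultant_eq_zero
    (MvPolynomial.eval₂Hom φ y) hp'0 (hp'e.trans hpe.symm) hres
  refine hBne t (Multiset.mem_toFinset.2 ht) ?_
  rw [mem_vanishingAt, eval₂Hom_cons]
  exact h0

/-- A system without common zeros over an algebraically closed extension of `K(μ)` yields a nonzero
polynomial by successive resultants. -/
theorem exists_obtainedByResultants [Infinite K] (hφ : Function.Injective φ) {m : ℕ}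
    {S : Set (MvPolynomial (Fin m) (Polynomial K))}
    (hS : ∀ y : Fin m → Ω, ¬ S ⊆ vanishingAt φ y) :
    ∃ P : Polynomial K, P ≠ 0 ∧ ObtainedByResultants m S P := by
  induction m with
  | zero =>
    obtain ⟨A, hA, hA0⟩ := Set.not_subset.1 (hS 0)
    refine ⟨MvPolynomial.coeff 0 A, ?_, ?_⟩
    · intro h
      apply hA0
      rw [MvPolynomial.eq_C_of_isEmpty A, h, map_zero]
      exact Submodule.zero_mem _
    · change MvPolynomial.C _ ∈ S
      rwa [← MvPolynomial.eq_C_of_isEmpty A]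
  | succ m ih =>
    obtain ⟨M, hM, hno⟩ := exists_eliminateFirst_no_zero φ hφ hS
    obtain ⟨P, hP0, hP⟩ := ih hno
    exact ⟨P, hP0, M, hM, hP⟩

end EliminationTheory

end MeroInt
namespace MeroInt

/-! ### The Jacobian matrix of a rational map -/

section RationalMaps

variable {K : Type} [Field K] {n : ℕ} {N D : Fin n → MvPolynomial (Fin n) K}

/-- The Jacobian matrix of the rational map `N / D` at a point with coordinates in an extension of
`K`, given by the quotient rule. -/
noncomputable def ratJacobian {Ω : Type*} [Field Ω] [Algebra K Ω]
    (N D : Fin n → MvPolynomial (Fin n) K) (x : Fin n → Ω) : Matrix (Fin n) (Fin n) Ω :=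
  Matrix.of fun i j => MvPolynomial.aeval x
    (MvPolynomial.pderiv j (N i) * D i - N i * MvPolynomial.pderiv j (D i)) /
      MvPolynomial.aeval x (D i) ^ 2

theorem fderiv_ratMap [Algebra K ℂ] {x : Fin n → ℂ} (hx : x ∈ ratDomain D) :
    (fderiv ℂ (ratMap N D) x : (Fin n → ℂ) →ₗ[ℂ] (Fin n → ℂ)) =
      Matrix.toLin' (ratJacobian N D x) := by
  have h : ∀ i, HasFDerivAt (fun y => ratMap N D y i)
      (∑ j, ratJacobian N D x i j • (ContinuousLinearMap.proj j : (Fin n → ℂ) →L[ℂ] ℂ)) x := by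
    intro i
    have h1 := (hasFDerivAt_aeval (N i) x).mul
      ((hasDerivAt_inv (hx i)).comp_hasFDerivAt x (hasFDerivAt_aeval (D i) x))
    simp only [ratMap, div_eq_mul_inv]
    refine h1.congr_fderiv ?_
    ext v
    simp only [ratJacobian, Matrix.of_apply, _root_.add_apply,
      _root_.smul_apply, _root_.sum_apply,
      ContinuousLinearMap.proj_apply, smul_eq_mul, Finset.mul_sum, Function.comp_apply]
    rw [← Finset.sum_add_distrib]
    refine Finset.sum_congr rfl fun j _ => ?_
    have := hx i
    simp only [map_sub, map_mul]
    field_simp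
    ring
  rw [(hasFDerivAt_pi.2 h).fderiv]
  ext v i
  simp [Matrix.mulVec, dotProduct, Pi.single_apply]

theorem isEigenvalueAt_ratMap_iff [Algebra K ℂ] {x : Fin n → ℂ} (hx : x ∈ ratDomain D) {μ : ℂ} :
    IsEigenvalueAt (ratMap N D) x μ ↔ (ratJacobian N D x).charpoly.eval μ = 0 := by
  rw [IsEigenvalueAt, fderiv_ratMap hx, Module.End.hasEigenvalue_iff_isRoot_charpoly,
    Matrix.charpoly_toLin']
  rfl

theorem eval₂Hom_liftCoeff {Ω : Type*} [Field Ω] [Algebra K Ω] (φ : Polynomial K →ₐ[K] Ω)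
    (x : Fin n → Ω) (A : MvPolynomial (Fin n) K) :
    MvPolynomial.eval₂Hom (φ : Polynomial K →+* Ω) x (liftCoeff A) = MvPolynomial.aeval x A := by
  have h : (φ : Polynomial K →+* Ω).comp Polynomial.C = algebraMap K Ω :=
    RingHom.ext fun c => φ.commutes c
  rw [liftCoeff, MvPolynomial.coe_eval₂Hom, MvPolynomial.eval₂_map, h]
  rfl

theorem eval₂Hom_det_charMatrixCleared {Ω : Type*} [Field Ω] [Algebra K Ω]
    (φ : Polynomial K →ₐ[K] Ω) {x : Fin n → Ω} (hx : ∀ i, MvPolynomial.aeval x (D i) ≠ 0) :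
    MvPolynomial.eval₂Hom (φ : Polynomial K →+* Ω) x (charMatrixCleared N D).det =
      (∏ i, MvPolynomial.aeval x (D i) ^ 2) *
        (ratJacobian N D x).charpoly.eval (φ Polynomial.X) := by
  rw [RingHom.map_det, Matrix.eval_charpoly, ← Matrix.det_mul_column]
  congr 1
  ext i j
  have h := hx i
  have h1 := eval₂Hom_liftCoeff φ x (D i)
  have h2 := eval₂Hom_liftCoeff φ x
    (MvPolynomial.pderiv j (N i) * D i - N i * MvPolynomial.pderiv j (D i))
  simp only [RingHom.mapMatrix_apply, Matrix.map_apply, charMatrixCleared, Matrix.of_apply,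
    Matrix.sub_apply, ratJacobian, Matrix.scalar_apply, Matrix.diagonal_apply]
  rw [map_sub, h2, mul_sub, mul_div_cancel₀ _ (pow_ne_zero 2 h)]
  congr 1
  split_ifs
  · rw [map_mul, map_pow, h1, MvPolynomial.eval₂Hom_C, mul_comm]
    rfl
  · rw [map_zero, mul_zero]

/-- Where no denominator of the map vanishes, the numerator of the characteristic polynomial has
the same zeros as the characteristic polynomial: the cancelled denominator divides a product of the
denominators of the map. -/
theorem IsCharpolyNumerator.eval₂Hom_eq_zero_iff {R : MvPolynomial (Fin n) (Polynomial K)}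
    (hR : IsCharpolyNumerator N D R) {Ω : Type*} [Field Ω] [Algebra K Ω]
    (φ : Polynomial K →ₐ[K] Ω) {x : Fin n → Ω} (hx : ∀ i, MvPolynomial.aeval x (D i) ≠ 0) :
    MvPolynomial.eval₂Hom (φ : Polynomial K →+* Ω) x R = 0 ↔
      (ratJacobian N D x).charpoly.eval (φ Polynomial.X) = 0 := by
  obtain ⟨E, hRE, hE⟩ := hR
  have hdvd : E ∣ ∏ i, liftCoeff (D i) ^ 2 :=
    hRE.symm.dvd_of_dvd_mul_left (Dvd.intro _ hE)
  have hprod : MvPolynomial.eval₂Hom (φ : Polynomial K →+* Ω) x (∏ i, liftCoeff (D i) ^ 2) =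
      ∏ i, MvPolynomial.aeval x (D i) ^ 2 := by
    simp only [map_prod, map_pow, eval₂Hom_liftCoeff]
  have hne : ∏ i, MvPolynomial.aeval x (D i) ^ 2 ≠ 0 :=
    Finset.prod_ne_zero_iff.2 fun i _ => pow_ne_zero 2 (hx i)
  have hE0 : MvPolynomial.eval₂Hom (φ : Polynomial K →+* Ω) x E ≠ 0 := fun h => by
    have := map_dvd (MvPolynomial.eval₂Hom (φ : Polynomial K →+* Ω) x) hdvd
    rw [h, hprod, zero_dvd_iff] at this
    exact hne this
  have h := congrArg (MvPolynomial.eval₂Hom (φ : Polynomial K →+* Ω) x) hE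
  rw [map_mul, map_mul, hprod, eval₂Hom_det_charMatrixCleared φ hx,
    mul_comm (MvPolynomial.eval₂Hom _ x R), mul_left_comm] at h
  have h := mul_left_cancel₀ hne h
  rw [← h, mul_eq_zero, or_iff_right hE0]

/-- The common zeros of the fixed point system are the pairs of a fixed point and the inverse of
the product of the denominators, such that `μ` is a root of the characteristic polynomial. -/
theorem fixedPointSystem_subset_vanishingAt_iff {R : MvPolynomial (Fin n) (Polynomial K)}
    (hR : IsCharpolyNumerator N D R) {Ω : Type*} [Field Ω] [Algebra K Ω]
    (φ : Polynomial K →ₐ[K] Ω) {t : Ω} {x : Fin n → Ω} :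
    fixedPointSystem N D R ⊆
        vanishingAt (φ : Polynomial K →+* Ω) (Fin.cons t x : Fin (n + 1) → Ω) ↔
      (∀ i, MvPolynomial.aeval x (N i - MvPolynomial.X i * D i) = 0) ∧
        t * MvPolynomial.aeval x (∏ i, D i) = 1 ∧
        (ratJacobian N D x).charpoly.eval (φ Polynomial.X) = 0 := by
  have h2 : 1 - MvPolynomial.X 0 * MvPolynomial.rename Fin.succ (liftCoeff (∏ i, D i)) ∈
      vanishingAt (φ : Polynomial K →+* Ω) (Fin.cons t x : Fin (n + 1) → Ω) ↔
        t * MvPolynomial.aeval x (∏ i, D i) = 1 := by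
    rw [mem_vanishingAt, map_sub, map_one, map_mul, eval₂Hom_rename_succ, eval₂Hom_liftCoeff,
      MvPolynomial.eval₂Hom_X', Fin.cons_zero, sub_eq_zero, eq_comm]
  rw [fixedPointSystem, Set.union_subset_iff, Set.range_subset_iff, Set.insert_subset_iff,
    Set.singleton_subset_iff]
  simp only [SetLike.mem_coe]
  rw [h2]
  simp only [mem_vanishingAt, eval₂Hom_rename_succ, eval₂Hom_liftCoeff]
  refine and_congr_right fun _ => and_congr_right fun ht => ?_
  refine hR.eval₂Hom_eq_zero_iff φ fun i hi => ?_
  rw [map_prod, Finset.prod_eq_zero (Finset.mem_univ i) hi, mul_zero] at ht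
  exact zero_ne_one ht

theorem ratMap_eq_iff [Algebra K ℂ] {x : Fin n → ℂ} (hx : x ∈ ratDomain D) :
    ratMap N D x = x ↔ ∀ i, MvPolynomial.aeval x (N i - MvPolynomial.X i * D i) = 0 := by
  rw [funext_iff]
  refine forall_congr' fun i => ?_
  rw [ratMap, div_eq_iff (hx i), map_sub, map_mul, MvPolynomial.aeval_X, sub_eq_zero]

/-- The polynomials obtained by successive resultants annihilate the eigenvalues at the fixed
points. -/
theorem aeval_eq_zero_of_obtainedByResultants [Algebra K ℂ]
    {R : MvPolynomial (Fin n) (Polynomial K)} (hR : IsCharpolyNumerator N D R) {P : Polynomial K}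
    (hP : ObtainedByResultants (n + 1) (fixedPointSystem N D R) P) {q : Fin n → ℂ}
    (hqU : q ∈ ratDomain D) (hq : ratMap N D q = q) {μ : ℂ}
    (hμ : IsEigenvalueAt (ratMap N D) q μ) : Polynomial.aeval μ P = 0 := by
  have hprod : MvPolynomial.aeval q (∏ i, D i) ≠ 0 := by
    rw [map_prod]
    exact Finset.prod_ne_zero_iff.2 fun i _ => hqU i
  have hchar : (ratJacobian N D q).charpoly.eval
      ((Polynomial.aeval μ : Polynomial K →ₐ[K] ℂ) Polynomial.X) = 0 := by
    rw [Polynomial.aeval_X]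
    exact (isEigenvalueAt_ratMap_iff hqU).1 hμ
  exact ObtainedByResultants.map_eq_zero _ hP
    ((fixedPointSystem_subset_vanishingAt_iff hR (Polynomial.aeval μ)).2
      ⟨(ratMap_eq_iff hqU).1 hq, inv_mul_cancel₀ hprod, hchar⟩)

/-! ### Fixed points over an extension of the ground field -/

/-- A consequence of the Nullstellensatz: an implication between polynomial equations with
coefficients in `K` that holds in `ℂ` holds in every extension of `K`. -/
theorem aeval_eq_zero_of_forall_complex [Algebra K ℂ] {σ : Type*} [Finite σ]
    {S : Set (MvPolynomial σ K)} {g : MvPolynomial σ K}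
    (h : ∀ z : σ → ℂ, (∀ p ∈ S, MvPolynomial.aeval z p = 0) → MvPolynomial.aeval z g = 0)
    {Ω : Type*} [Field Ω] [Algebra K Ω] {x : σ → Ω}
    (hx : ∀ p ∈ S, MvPolynomial.aeval x p = 0) : MvPolynomial.aeval x g = 0 := by
  have hg : g ∈ (Ideal.span S).radical := by
    rw [← MvPolynomial.vanishingIdeal_zeroLocus_eq_radical (K := ℂ),
      MvPolynomial.mem_vanishingIdeal_iff]
    exact fun z hz => h z fun p hp => hz p (Ideal.subset_span hp)
  obtain ⟨r, hr⟩ := hg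
  have hle : Ideal.span S ≤ RingHom.ker (MvPolynomial.aeval x : MvPolynomial σ K →ₐ[K] Ω) :=
    Ideal.span_le.2 fun p hp => hx p hp
  have := hle hr
  rw [RingHom.mem_ker, map_pow] at this
  exact eq_zero_of_pow_eq_zero this

theorem derivation_aeval {Ω M : Type*} [Field Ω] [Algebra K Ω] [AddCommGroup M] [Module Ω M]
    [Module K M] (d : Derivation K Ω M) (x : Fin n → Ω) (P : MvPolynomial (Fin n) K) :
    d (MvPolynomial.aeval x P) =
      ∑ j, MvPolynomial.aeval x (MvPolynomial.pderiv j P) • d (x j) := by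
  induction P using MvPolynomial.induction_on with
  | C c => simp
  | add P Q hP hQ => simp only [map_add, hP, hQ, add_smul, Finset.sum_add_distrib]
  | mul_X P i hP =>
    simp only [map_mul, MvPolynomial.aeval_X, Derivation.leibniz, hP, MvPolynomial.pderiv_X,
      smul_eq_mul, map_add, add_smul, Finset.sum_add_distrib, Finset.smul_sum, smul_smul]
    simp [Pi.single_apply, apply_ite, ite_smul]

/-- A common zero of `n` polynomials in `n` unknowns at which the Jacobian determinant does not
vanish is algebraic over the field of coefficients: the field it generates has no nonzero
derivations. -/
theorem isAlgebraic_of_jacobian_ne_zero {Ω : Type*} [Field Ω] [Algebra K Ω]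
    {h : Fin n → MvPolynomial (Fin n) K} {x : Fin n → Ω}
    (hx : ∀ i, MvPolynomial.aeval x (h i) = 0)
    (hdet : MvPolynomial.aeval x
      (Matrix.of fun i j => MvPolynomial.pderiv j (h i)).det ≠ 0) (j : Fin n) :
    IsAlgebraic K (x j) := by
  set L := IntermediateField.adjoin K (Set.range x) with hL
  have hmem : ∀ j, x j ∈ L := fun j => IntermediateField.subset_adjoin _ _ ⟨j, rfl⟩
  set x' : Fin n → L := fun j => ⟨x j, hmem j⟩ with hx'
  have haeval : ∀ P : MvPolynomial (Fin n) K,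
      ((MvPolynomial.aeval x' P : L) : Ω) = MvPolynomial.aeval x P := fun P =>
    (MvPolynomial.aeval_algebraMap_apply (B := Ω) x' P).symm
  set J : Matrix (Fin n) (Fin n) L :=
    Matrix.of fun i j => MvPolynomial.aeval x' (MvPolynomial.pderiv j (h i)) with hJ
  have hJdet : IsUnit J.det := by
    rw [isUnit_iff_ne_zero]
    intro h0
    apply hdet
    rw [← haeval, AlgHom.map_det]
    exact (congrArg (fun a : L => (a : Ω)) h0)
  -- the chain rule forces the differentials of the coordinates to vanish
  have hdx : ∀ j, KaehlerDifferential.D K L (x' j) = 0 := by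
    intro j
    have h1 : ∀ i, ∑ j, J i j • KaehlerDifferential.D K L (x' j) = 0 := fun i => by
      have h2 : MvPolynomial.aeval x' (h i) = 0 := Subtype.ext ((haeval _).trans (hx i))
      rw [← map_zero (KaehlerDifferential.D K L), ← h2, derivation_aeval]
      rfl
    have h3 : ∑ i, J⁻¹ j i • ∑ k, J i k • KaehlerDifferential.D K L (x' k) =
        KaehlerDifferential.D K L (x' j) := by
      simp only [Finset.smul_sum, smul_smul]
      rw [Finset.sum_comm]
      simp only [← Finset.sum_smul]
      have h4 : ∀ k, ∑ i, J⁻¹ j i * J i k = (1 : Matrix (Fin n) (Fin n) L) j k := fun k => by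
        rw [← Matrix.mul_apply, Matrix.nonsing_inv_mul _ hJdet]
      simp [h4, Matrix.one_apply, ite_smul]
    rw [← h3]
    simp [h1]
  have hd : ∀ (a : Ω) (ha : a ∈ L), KaehlerDifferential.D K L ⟨a, ha⟩ = 0 := by
    intro a ha
    induction ha using IntermediateField.adjoin_induction with
    | mem a ha =>
      obtain ⟨j, rfl⟩ := ha
      exact hdx j
    | algebraMap c => exact (KaehlerDifferential.D K L).map_algebraMap c
    | add a b ha hb iha ihb =>
      exact ((KaehlerDifferential.D K L).map_add ⟨a, ha⟩ ⟨b, hb⟩).trans (by rw [iha, ihb, add_zero])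
    | inv a ha iha =>
      exact ((KaehlerDifferential.D K L).leibniz_inv ⟨a, ha⟩).trans (by rw [iha, smul_zero])
    | mul a b ha hb iha ihb =>
      exact ((KaehlerDifferential.D K L).leibniz ⟨a, ha⟩ ⟨b, hb⟩).trans
        (by rw [iha, ihb, smul_zero, smul_zero, add_zero])
  have hsub : Subsingleton (Ω[L⁄K]) := by
    rw [← Submodule.subsingleton_iff L, ← subsingleton_iff_bot_eq_top,
      ← KaehlerDifferential.span_range_derivation, eq_comm, Submodule.span_eq_bot]
    rintro _ ⟨a, rfl⟩
    exact hd a.1 a.2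
  have hun : Algebra.FormallyUnramified K L := ⟨hsub⟩
  have hfg : Algebra.EssFiniteType K L :=
    IntermediateField.essFiniteType_iff.2
      (IntermediateField.fg_adjoin_of_finite (Set.finite_range x))
  have := Algebra.FormallyUnramified.isSeparable K L
  have := (Algebra.IsAlgebraic.isAlgebraic (R := K) (x' j)).algebraMap (A := Ω)
  exact this

/-- At a fixed point of an integrable map, the fixed point equations have a nonzero Jacobian
determinant, because `1` is not an eigenvalue. -/
theorem IsIntegrableMap.jacobian_ne_zero [Algebra K ℂ]
    (hU : IsIntegrableMap (ratDomain D) (ratMap N D)) {q : Fin n → ℂ} (hqU : q ∈ ratDomain D)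
    (hq : ratMap N D q = q) :
    MvPolynomial.aeval q (Matrix.of fun i j =>
      MvPolynomial.pderiv j (N i - MvPolynomial.X i * D i)).det ≠ 0 := by
  intro h0
  apply hU.not_hasEigenvalue_one hqU hq
  rw [isEigenvalueAt_ratMap_iff hqU, Matrix.eval_charpoly]
  have h1 : ((MvPolynomial.aeval q : MvPolynomial (Fin n) K →ₐ[K] ℂ).mapMatrix
      (Matrix.of fun i j => MvPolynomial.pderiv j (N i - MvPolynomial.X i * D i))) =
      Matrix.of fun i j => (-MvPolynomial.aeval q (D i)) *
        (Matrix.scalar (Fin n) (1 : ℂ) - ratJacobian N D q) i j := by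
    ext i j
    have hi := hqU i
    have hN := (ratMap_eq_iff hqU).1 hq i
    rw [map_sub, map_mul, MvPolynomial.aeval_X, sub_eq_zero] at hN
    simp only [AlgHom.mapMatrix_apply, Matrix.map_apply, Matrix.of_apply, Matrix.sub_apply,
      Matrix.scalar_apply, Matrix.diagonal_apply, ratJacobian, map_sub, map_mul,
      Derivation.leibniz, MvPolynomial.pderiv_X, smul_eq_mul, map_add, MvPolynomial.aeval_X, hN]
    rcases eq_or_ne i j with rfl | hij
    · simp only [Pi.single_eq_same, map_one, if_true]
      field_simp
      ring
    · simp only [Pi.single_eq_of_ne hij, map_zero, if_neg hij]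
      field_simp
      ring
  rw [AlgHom.map_det, h1, Matrix.det_mul_column] at h0
  exact (mul_eq_zero.1 h0).resolve_left
    (Finset.prod_ne_zero_iff.2 fun i _ => neg_ne_zero.2 (hqU i))

/-- The roots of the characteristic polynomial are algebraic over `K` at the points with
coordinates algebraic over `K`. -/
theorem isAlgebraic_of_charpoly_eq_zero {Ω : Type*} [Field Ω] [Algebra K Ω] {x : Fin n → Ω}
    (hx : ∀ j, IsAlgebraic K (x j)) {μ : Ω}
    (hμ : (ratJacobian N D x).charpoly.eval μ = 0) : IsAlgebraic K μ := by
  set L := integralClosure K Ω with hL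
  have hmem : ∀ P : MvPolynomial (Fin n) K, MvPolynomial.aeval x P ∈ L := fun P => by
    have : MvPolynomial.aeval x P =
        ((MvPolynomial.aeval (fun j => (⟨x j, (hx j).isIntegral⟩ : L)) P : L) : Ω) :=
      MvPolynomial.aeval_algebraMap_apply (B := Ω) (fun j => (⟨x j, (hx j).isIntegral⟩ : L)) P
    rw [this]
    exact Subtype.property _
  have hJ : ∀ i j, ratJacobian N D x i j ∈ L := fun i j => by
    rw [ratJacobian, Matrix.of_apply, div_eq_mul_inv]
    exact mul_mem (hmem _) (IsIntegral.inv (pow_mem (hmem (D i)) 2))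
  set J : Matrix (Fin n) (Fin n) L := Matrix.of fun i j => ⟨_, hJ i j⟩
  have hchar : (ratJacobian N D x).charpoly = J.charpoly.map (algebraMap L Ω) := by
    rw [← Matrix.charpoly_map]
    rfl
  have hint : IsIntegral L μ := ⟨J.charpoly, J.charpoly_monic, by
    rw [← Polynomial.eval_map, ← hchar, hμ]⟩
  exact (isIntegral_trans (R := K) (A := L) μ hint).isAlgebraic

/-- Successive resultants yield a nonzero polynomial: over an algebraic closure of `K(μ)` the
fixed point system has no zeros, since the fixed points, hence the eigenvalues, are algebraic over
`K`, whereas `μ` is not. -/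
theorem IsIntegrableMap.exists_obtainedByResultants [Algebra K ℂ]
    (hU : IsIntegrableMap (ratDomain D) (ratMap N D))
    {R : MvPolynomial (Fin n) (Polynomial K)} (hR : IsCharpolyNumerator N D R) :
    ∃ P : Polynomial K, P ≠ 0 ∧ ObtainedByResultants (n + 1) (fixedPointSystem N D R) P := by
  have : CharZero K := (algebraMap K ℂ).charZero
  set Ω := AlgebraicClosure (FractionRing (Polynomial K))
  set φ : Polynomial K →ₐ[K] Ω := IsScalarTower.toAlgHom K (Polynomial K) Ω
  have hφ : Function.Injective φ := by
    rw [IsScalarTower.coe_toAlgHom', IsScalarTower.algebraMap_eq _ (FractionRing (Polynomial K))]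
    exact (algebraMap (FractionRing (Polynomial K)) Ω).injective.comp (IsFractionRing.injective _ _)
  refine MeroInt.exists_obtainedByResultants (φ : Polynomial K →+* Ω) hφ fun y hy => ?_
  rw [← Fin.cons_self_tail y, fixedPointSystem_subset_vanishingAt_iff hR φ] at hy
  obtain ⟨hfix, ht, hchar⟩ := hy
  set x := Fin.tail y
  have hdet : MvPolynomial.aeval x (Matrix.of fun i j =>
      MvPolynomial.pderiv j (N i - MvPolynomial.X i * D i)).det ≠ 0 := by
    intro h0
    have hprod : MvPolynomial.aeval x (∏ i, D i) = 0 := by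
      refine aeval_eq_zero_of_forall_complex (S := insert (Matrix.of fun i j =>
        MvPolynomial.pderiv j (N i - MvPolynomial.X i * D i)).det
          (Set.range fun i => N i - MvPolynomial.X i * D i)) (fun z hz => ?_) ?_
      · rw [Set.forall_mem_insert, Set.forall_mem_range] at hz
        by_contra hne
        have hzU : z ∈ ratDomain D := fun i hi => by
          rw [map_prod] at hne
          exact hne (Finset.prod_eq_zero (Finset.mem_univ i) hi)
        exact hU.jacobian_ne_zero hzU ((ratMap_eq_iff hzU).2 hz.2) hz.1
      · rw [Set.forall_mem_insert, Set.forall_mem_range]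
        exact ⟨h0, hfix⟩
    rw [hprod, mul_zero] at ht
    exact zero_ne_one ht
  have halg : IsAlgebraic K (φ Polynomial.X) :=
    isAlgebraic_of_charpoly_eq_zero (isAlgebraic_of_jacobian_ne_zero hfix hdet) hchar
  exact Polynomial.transcendental_X K ((isAlgebraic_algHom_iff φ hφ).1 halg)

end RationalMaps

end MeroInt
namespace MeroInt

/-! ### Rational coefficients: cyclotomic polynomials -/

theorem bddAbove_totient_le (k : ℕ) : BddAbove {m : ℕ | 0 < m ∧ Nat.totient m ≤ k} := by
  refine ⟨k * ∏ i ∈ Finset.Icc 1 (k + 1), i, ?_⟩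
  rintro m ⟨hm, hmk⟩
  have hprod : ∏ p ∈ m.primeFactors, p ≤ ∏ i ∈ Finset.Icc 1 (k + 1), i := by
    refine Finset.prod_le_prod_of_subset_of_one_le' (fun p hp => ?_)
      fun p hp _ => (Finset.mem_Icc.1 hp).1
    have hpp := Nat.prime_of_mem_primeFactors hp
    have h1 : Nat.totient p ≤ Nat.totient m := Nat.le_of_dvd (Nat.totient_pos.2 hm)
      (Nat.totient_dvd_of_dvd (Nat.dvd_of_mem_primeFactors hp))
    rw [Nat.totient_prime hpp] at h1
    exact Finset.mem_Icc.2 ⟨hpp.one_le, by omega⟩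
  have hpos : 0 < ∏ p ∈ m.primeFactors, (p - 1) := Finset.prod_pos fun p hp =>
    Nat.sub_pos_of_lt (Nat.prime_of_mem_primeFactors hp).one_lt
  calc m ≤ m * ∏ p ∈ m.primeFactors, (p - 1) := Nat.le_mul_of_pos_right m hpos
    _ = Nat.totient m * ∏ p ∈ m.primeFactors, p := (Nat.totient_mul_prod_primeFactors m).symm
    _ ≤ k * ∏ i ∈ Finset.Icc 1 (k + 1), i := Nat.mul_le_mul hmk hprod

theorem exists_isGreatest_totient_le {k p : ℕ} (hp : 0 < p) (hpk : Nat.totient p ≤ k) :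
    ∃ M, IsGreatest {m : ℕ | 0 < m ∧ Nat.totient m ≤ k} M :=
  ⟨_, Nat.sSup_mem ⟨p, hp, hpk⟩ (bddAbove_totient_le k),
    fun _ hm => le_csSup (bddAbove_totient_le k) hm⟩

/-- A nonzero rational polynomial annihilating a root of unity is a multiple of a cyclotomic
polynomial. -/
theorem exists_isPrimitiveRoot_cyclotomic_dvd {P : Polynomial ℚ} {μ : ℂ}
    (hP : Polynomial.aeval μ P = 0) {r : ℕ} (hr : 0 < r) (hμ : μ ^ r = 1) :
    ∃ p : ℕ, 0 < p ∧ IsPrimitiveRoot μ p ∧ Polynomial.cyclotomic p ℚ ∣ P := by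
  have hpos : 0 < orderOf μ := (isOfFinOrder_iff_pow_eq_one.2 ⟨r, hr, hμ⟩).orderOf_pos
  refine ⟨orderOf μ, hpos, IsPrimitiveRoot.orderOf μ, ?_⟩
  rw [Polynomial.cyclotomic_eq_minpoly_rat (IsPrimitiveRoot.orderOf μ) hpos]
  exact minpoly.dvd ℚ μ hP

theorem exists_isEigenvalueAt {n : ℕ} (hn : 0 < n) (f : (Fin n → ℂ) → (Fin n → ℂ))
    (q : Fin n → ℂ) : ∃ μ, IsEigenvalueAt f q μ := by
  have : Nonempty (Fin n) := ⟨⟨0, hn⟩⟩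
  exact Module.End.exists_eigenvalue _

theorem resultant_eq_zero_of_dvd {F : Type*} [Field F] {A B : Polynomial F}
    (hA : 0 < A.natDegree) (h : A ∣ B) : Polynomial.resultant A B = 0 := by
  rw [Polynomial.resultant_eq_zero_iff]
  have hA0 : A ≠ 0 := fun h0 => by simp [h0] at hA
  exact ⟨Or.inl hA0, fun hcop =>
    hA.ne' (Polynomial.natDegree_eq_zero_of_isUnit (hcop.isUnit_of_dvd' dvd_rfl h))⟩

end MeroInt

theorem mainTheorem3 (n : ℕ) (hn : 0 < n) :
    -- analytic maps: the eigenvalues at each fixed point are `p`-th roots of unity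
    (∀ (U : Set (Fin n → ℂ)) (f : (Fin n → ℂ) → (Fin n → ℂ)), MeroInt.IsIntegrableMap U f →
      ∀ q ∈ U, f q = q → ∃ p : ℕ, 0 < p ∧ ∀ μ : ℂ, MeroInt.IsEigenvalueAt f q μ → μ ^ p = 1) ∧
    -- entire maps: one nonzero polynomial annihilates the eigenvalues at all fixed points
    (∀ f : (Fin n → ℂ) → (Fin n → ℂ), MeroInt.IsIntegrableMap Set.univ f →
      ∃ P : Polynomial ℂ, P ≠ 0 ∧
        ∀ q : Fin n → ℂ, f q = q → ∀ μ : ℂ, MeroInt.IsEigenvalueAt f q μ → P.eval μ = 0) ∧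
    -- rational maps with coefficients in `K` (for instance `K = ℂ` or `K = ℚ`): successive
    -- resultants give such a polynomial with coefficients in `K`
    (∀ (K : Type) [Field K] [Algebra K ℂ] (N D : Fin n → MvPolynomial (Fin n) K)
      (R : MvPolynomial (Fin n) (Polynomial K)),
      (∀ i, D i ≠ 0) → (∀ i, IsRelPrime (N i) (D i)) → MeroInt.IsCharpolyNumerator N D R →
      MeroInt.IsIntegrableMap (MeroInt.ratDomain D) (MeroInt.ratMap N D) →
      (∃ P : Polynomial K, P ≠ 0 ∧
        MeroInt.ObtainedByResultants (n + 1) (MeroInt.fixedPointSystem N D R) P) ∧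
      (∀ P : Polynomial K,
        MeroInt.ObtainedByResultants (n + 1) (MeroInt.fixedPointSystem N D R) P →
        ∀ q ∈ MeroInt.ratDomain D, MeroInt.ratMap N D q = q →
          ∀ μ : ℂ, MeroInt.IsEigenvalueAt (MeroInt.ratMap N D) q μ →
            Polynomial.aeval μ P = 0)) ∧
    -- rational maps with rational coefficients
    (∀ (N D : Fin n → MvPolynomial (Fin n) ℚ) (R : MvPolynomial (Fin n) (Polynomial ℚ)),
      (∀ i, D i ≠ 0) → (∀ i, IsRelPrime (N i) (D i)) → MeroInt.IsCharpolyNumerator N D R →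
      MeroInt.IsIntegrableMap (MeroInt.ratDomain D) (MeroInt.ratMap N D) →
      ∀ P : Polynomial ℚ, P ≠ 0 →
        MeroInt.ObtainedByResultants (n + 1) (MeroInt.fixedPointSystem N D R) P →
        ∀ q ∈ MeroInt.ratDomain D, MeroInt.ratMap N D q = q →
          (∃ M : ℕ, IsGreatest
              {m : ℕ | 0 < m ∧ (Polynomial.cyclotomic m ℚ).natDegree ≤ P.natDegree} M ∧
            ∀ μ : ℂ, MeroInt.IsEigenvalueAt (MeroInt.ratMap N D) q μ →
              ∃ p : ℕ, 0 < p ∧ p ≤ M ∧ IsPrimitiveRoot μ p) ∧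
          (∃ j : ℕ, 0 < j ∧ (Polynomial.cyclotomic j ℚ).natDegree ≤ P.natDegree ∧
            Polynomial.resultant (Polynomial.cyclotomic j ℚ) P = 0)) := by
  refine ⟨fun U f hU q hqU hq => hU.exists_pow_eq_one hqU hq,
    fun f hU => hU.exists_polynomial_of_entire,
    fun K _ _ N D R _ _ hR hU => ⟨hU.exists_obtainedByResultants hR,
      fun P hP q hqU hq μ hμ => MeroInt.aeval_eq_zero_of_obtainedByResultants hR hP hqU hq hμ⟩,
    fun N D R _ _ hR hU P hP0 hP q hqU hq => ?_⟩
  obtain ⟨r, hr, hroot⟩ := hU.exists_pow_eq_one hqU hq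
  have hcyc : ∀ μ : ℂ, MeroInt.IsEigenvalueAt (MeroInt.ratMap N D) q μ → ∃ p : ℕ, 0 < p ∧
      IsPrimitiveRoot μ p ∧ Polynomial.cyclotomic p ℚ ∣ P := fun μ hμ =>
    MeroInt.exists_isPrimitiveRoot_cyclotomic_dvd
      (MeroInt.aeval_eq_zero_of_obtainedByResultants hR hP hqU hq hμ) hr (hroot μ hμ)
  obtain ⟨μ, hμ⟩ := MeroInt.exists_isEigenvalueAt hn (MeroInt.ratMap N D) q
  obtain ⟨j, hj, -, hjP⟩ := hcyc μ hμ
  have hjdeg := Polynomial.natDegree_le_of_dvd hjP hP0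
  refine ⟨?_, j, hj, hjdeg, MeroInt.resultant_eq_zero_of_dvd ?_ hjP⟩
  · simp only [Polynomial.natDegree_cyclotomic] at hjdeg ⊢
    obtain ⟨M, hM⟩ := MeroInt.exists_isGreatest_totient_le hj hjdeg
    refine ⟨M, hM, fun μ hμ => ?_⟩
    obtain ⟨p, hp, hprim, hpP⟩ := hcyc μ hμ
    have hpdeg := Polynomial.natDegree_le_of_dvd hpP hP0
    rw [Polynomial.natDegree_cyclotomic] at hpdeg
    exact ⟨p, hp, hM.2 ⟨hp, hpdeg⟩, hprim⟩
  · rw [Polynomial.natDegree_cyclotomic]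
    exact Nat.totient_pos.2 hj
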